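/- Let $k$ be a field and let $\mathbb{U} = \{(x,y) \in \mathbb{R}^2 \mid x \le y\}$ with the order inherited from $\mathbb{R}^{\mathrm{op}} \times \mathbb{R}$, i.e. $(x,y) \le (x',y')$ iff $x' \le x$ and $y \le y'$. A $\mathbb{U}$-module is a functor $M$ from $\mathbb{U}$ to $k$-vector spaces, with internal maps $\phi_M(p,q) : M_p \to M_q$ for $p \le q$; it is p.f.d. if every $M_p$ is finite-dimensional. For an interval $I \subseteq \mathbb{U}$ (a nonempty, convex subset in which any two points are joined by a finite zigzag of comparable points of $I$), $\mathbb{I}^I$ denotes the interval module with $\mathbb{I}^I_p = k$ for $p \in I$, $\mathbb{I}^I_p = 0$ for $p \notin I$, and identity internal maps between points of $I$. A multiset $B(M)$ of intervals is the barcode of $M$ if $M \cong \bigoplus_{I \in B(M)} \mathbb{I}^I$. The module $M$ is block decomposable if it has a barcode all of whose members are of one of the forms (as subsets of $\mathbb{U}$) \begin{align*} &\{(x,y) \mid a < x,\ y < b\} && \text{for } a < b \text{ in } \mathbb{R} \cup \{-\infty,\infty\},\\ &\{(x,y) \mid a \le y < b\} && \text{for } a < b \text{ in } \mathbb{R} \cup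 \{\infty\},\\ &\{(x,y) \mid a < x \le b\} && \text{for } a < b \text{ in } \mathbb{R} \cup \{-\infty\},\\ &\{(x,y) \mid x \le b,\ y \ge a\} && \text{for } a, b \in \mathbb{R}. \end{align*} For $\epsilon \ge 0$ and $p = (x,y) \in \mathbb{U}$ write $p + \epsilon = (x - \epsilon, y + \epsilon)$, and let $M(\epsilon)$ be the module $M(\epsilon)_p = M_{p+\epsilon}$, $\phi_{M(\epsilon)}(p,q) = \phi_M(p+\epsilon,q+\epsilon)$. Modules $M$ and $N$ are $\epsilon$-interleaved if there are morphisms $f : M \to N(\epsilon)$ and $g : N \to M(\epsilon)$ with $g_{p+\epsilon} \circ f_p = \phi_M(p,p+2\epsilon)$ and $f_{p+\epsilon} \circ g_p = \phi_N(p,p+2\epsilon)$ for all $p \in \mathbb{U}$. An interval $I$ is $2\epsilon$-trivial if $\phi_{\mathbb{I}^I}(p,p+2\epsilon) = 0$ for all $p$. The modules $M$ and $N$ are $\epsilon$-matched if there is a bijection $\sigma$ from a subset of $B(M)$ to a subset of $B(N)$ such that every interval of $B(M)$ and of $B(N)$ that is not matched by $\sigma$ is $2\epsilon$-trivial, and $\mathbb{I}^I$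 and $\mathbb{I}^{\sigma(I)}$ are $\epsilon$-interleaved for every $I$ in the domain of $\sigma$. **Theorem.** Let $M$ and $N$ be p.f.d. block decomposable $\mathbb{U}$-modules and let $\epsilon \ge 0$. Then $M$ and $N$ are $\epsilon$-matched if and only if they are $\epsilon$-interleaved. -/

import Mathlib

open CategoryTheory
open scoped NNReal DirectSum

universe u v v' w

noncomputable section

namespace Persistence

/-- Intervals of a poset: nonempty, convex, and connected through zigzags of comparable
elements of the set. -/
structure PosetInterval (P : Type v) [PartialOrder P] where
  carrier : Set P
  nonempty : carrier.Nonempty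
  convex : ∀ ⦃p q r : P⦄, p ∈ carrier → q ∈ carrier → p ≤ r → r ≤ q → r ∈ carrier
  connected : ∀ p q : carrier,
    Relation.ReflTransGen (fun r s : carrier => r ≤ s ∨ s ≤ r) p q

section IntervalModule

variable {P : Type v} [PartialOrder P] (k : Type u) [Field k]

/-- The space of an interval module at `p`, as a subspace of `k`:
all of `k` if `p ∈ I`, and `0` otherwise. -/
def intervalSpace (I : PosetInterval P) (p : P) : Submodule k k where
  carrier := {x | p ∉ I.carrier → x = 0}
  add_mem' := fun ha hb h => by rw [ha h, hb h, add_zero]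
  zero_mem' := fun _ => rfl
  smul_mem' := fun c x hx h => by rw [hx h, smul_zero]

theorem intervalSpace_of_mem (I : PosetInterval P) {p : P} (hp : p ∈ I.carrier) :
    intervalSpace k I p = ⊤ :=
  eq_top_iff.2 fun _ _ h => absurd hp h

theorem intervalSpace_of_notMem (I : PosetInterval P) {p : P} (hp : p ∉ I.carrier) :
    intervalSpace k I p = ⊥ :=
  eq_bot_iff.2 fun _ hx => hx hp

open Classical in
/-- The internal map from `p` to `q`: the identity of `k` if `p` and `q` are both in `I` (for
`p ∉ I` the source is `0`), and `0` otherwise. -/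
def intervalMap (I : PosetInterval P) (p q : P) :
    intervalSpace k I p →ₗ[k] intervalSpace k I q where
  toFun x := ⟨if q ∈ I.carrier then (x : k) else 0, fun hq => if_neg hq⟩
  map_add' x y := by
    apply Subtype.ext
    by_cases h : q ∈ I.carrier <;> simp [h]
  map_smul' c x := by
    apply Subtype.ext
    by_cases h : q ∈ I.carrier <;> simp [h]

theorem intervalMap_coe_of_mem (I : PosetInterval P) {p q : P} (hq : q ∈ I.carrier)
    (x : intervalSpace k I p) : (intervalMap k I p q x : k) = x :=
  if_pos hq

theorem intervalMap_coe_of_notMem (I : PosetInterval P) {p q : P} (hq : q ∉ I.carrier)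
    (x : intervalSpace k I p) : (intervalMap k I p q x : k) = 0 :=
  if_neg hq

/-- The interval module supported on the interval `I`. -/
def intervalModule (I : PosetInterval P) : P ⥤ ModuleCat.{u} k where
  obj p := ModuleCat.of k (intervalSpace k I p)
  map {p q} _ := ModuleCat.ofHom (intervalMap k I p q)
  map_id p := by
    apply ModuleCat.hom_ext
    apply LinearMap.ext
    intro x
    apply Subtype.ext
    by_cases hp : p ∈ I.carrier
    · exact intervalMap_coe_of_mem k I hp x
    · exact (intervalMap_coe_of_notMem k I hp x).trans (x.2 hp).symm
  map_comp {p q r} f g := by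
    apply ModuleCat.hom_ext
    apply LinearMap.ext
    intro x
    apply Subtype.ext
    change (intervalMap k I p r x : k) = intervalMap k I q r (intervalMap k I p q x)
    by_cases hr : r ∈ I.carrier
    · rw [intervalMap_coe_of_mem k I hr, intervalMap_coe_of_mem k I hr]
      by_cases hq : q ∈ I.carrier
      · rw [intervalMap_coe_of_mem k I hq]
      · rw [intervalMap_coe_of_notMem k I hq]
        exact x.2 fun hp => hq (I.convex hp hr (leOfHom f) (leOfHom g))
    · rw [intervalMap_coe_of_notMem k I hr, intervalMap_coe_of_notMem k I hr]

end IntervalModule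

section Modules

variable {P : Type v} [PartialOrder P] {k : Type u} [Field k]

/-- Pointwise finite-dimensional persistence modules. -/
def IsPFD (M : P ⥤ ModuleCat.{w} k) : Prop :=
  ∀ p, Module.Finite k (M.obj p)

/-- The family `A` of intervals (a multiset, with its copies told apart by their indices) is a
barcode of `M`: there is an isomorphism of persistence modules between `M` and the direct sum of
the interval modules of `A`, i.e. a family of linear isomorphisms that commutes with the internal
maps. -/
def IsBarcode {ι : Type*} (M : P ⥤ ModuleCat.{w} k) (A : ι → PosetInterval P) : Prop :=
  ∃ e : ∀ p, M.obj p ≃ₗ[k] (⨁ i, (intervalModule k (A i)).obj p),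
    ∀ ⦃p q : P⦄ (h : p ⟶ q) (m : M.obj p),
      e q ((M.map h).hom m) =
        DirectSum.lmap (fun i => ((intervalModule k (A i)).map h).hom) (e p m)

end Modules

/-- The poset `𝕌 = {(x, y) | x ≤ y}`, with the order inherited from `ℝᵒᵖ × ℝ`. -/
abbrev 𝕌 : Type := {p : ℝᵒᵈ × ℝ // OrderDual.ofDual p.1 ≤ p.2}

namespace 𝕌

/-- The first coordinate, as a real number. -/
def x (p : 𝕌) : ℝ := OrderDual.ofDual p.1.1

/-- The second coordinate. -/
def y (p : 𝕌) : ℝ := p.1.2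

theorem x_le_y (p : 𝕌) : p.x ≤ p.y := p.2

theorem le_iff {p q : 𝕌} : p ≤ q ↔ q.x ≤ p.x ∧ p.y ≤ q.y := Iff.rfl

/-- The shift `(x, y) ↦ (x - ε, y + ε)`. -/
def shift (ε : ℝ≥0) (p : 𝕌) : 𝕌 :=
  ⟨(OrderDual.toDual (p.x - ε), p.y + ε), by
    have h := p.x_le_y
    have hε : (0 : ℝ) ≤ ε := ε.2
    change p.x - ε ≤ p.y + ε
    linarith⟩

theorem le_shift (ε : ℝ≥0) (p : 𝕌) : p ≤ shift ε p :=
  le_iff.2 ⟨sub_le_self p.x ε.2, le_add_of_nonneg_right ε.2⟩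

theorem shift_mono (ε : ℝ≥0) : Monotone (shift ε) := fun _ _ h =>
  le_iff.2 ⟨sub_le_sub_right (le_iff.1 h).1 _, by
    have h2 := (le_iff.1 h).2
    exact add_le_add_left h2 (ε : ℝ)⟩

end 𝕌

section Interleaving

variable {k : Type u} [Field k]

/-- The shifted module `M(ε)`. -/
def shiftModule (ε : ℝ≥0) (M : 𝕌 ⥤ ModuleCat.{w} k) : 𝕌 ⥤ ModuleCat.{w} k :=
  (𝕌.shift_mono ε).functor ⋙ M

/-- `M` and `N` are `ε`-interleaved: there are morphisms `f : M ⟶ N(ε)`, `g : N ⟶ M(ε)` such that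
`g(ε) ∘ f` and `f(ε) ∘ g` are given by the internal maps from `p` to `p` shifted twice by `ε`. -/
def Interleaved (ε : ℝ≥0) (M N : 𝕌 ⥤ ModuleCat.{w} k) : Prop :=
  ∃ (f : M ⟶ shiftModule ε N) (g : N ⟶ shiftModule ε M),
    (∀ p, f.app p ≫ g.app (𝕌.shift ε p) =
      M.map (homOfLE ((𝕌.le_shift ε p).trans (𝕌.le_shift ε (𝕌.shift ε p))))) ∧
    (∀ p, g.app p ≫ f.app (𝕌.shift ε p) =
      N.map (homOfLE ((𝕌.le_shift ε p).trans (𝕌.le_shift ε (𝕌.shift ε p)))))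

/-- `δ`-trivial modules: all internal maps from `p` to its shift by `δ` vanish. -/
def IsTrivial (δ : ℝ≥0) (M : 𝕌 ⥤ ModuleCat.{w} k) : Prop :=
  ∀ p, M.map (homOfLE (𝕌.le_shift δ p)) = 0

variable (k) in
/-- The partial bijection `σ` is an `ε`-matching between the families of intervals `A` and `B`. -/
structure IsMatching {ι κ : Type*} (ε : ℝ≥0) (A : ι → PosetInterval 𝕌) (B : κ → PosetInterval 𝕌)
    (σ : ι ≃. κ) : Prop where
  left : ∀ i, σ i = none → IsTrivial (2 * ε) (intervalModule k (A i))
  right : ∀ j, σ.symm j = none → IsTrivial (2 * ε) (intervalModule k (B j))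
  matched : ∀ i j, σ i = some j →
    Interleaved ε (intervalModule k (A i)) (intervalModule k (B j))

end Interleaving

/-- The four forms of blocks. -/
inductive IsBlock (I : PosetInterval 𝕌) : Prop
  | openBlock (a b : EReal) (hab : a < b)
      (h : I.carrier = {p | a < (p.x : EReal) ∧ (p.y : EReal) < b})
  | closedOpenBlock (a : ℝ) (b : EReal) (hab : (a : EReal) < b)
      (h : I.carrier = {p | a ≤ p.y ∧ (p.y : EReal) < b})
  | openClosedBlock (a : EReal) (b : ℝ) (hab : a < (b : EReal))
      (h : I.carrier = {p | a < (p.x : EReal) ∧ p.x ≤ b})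
  | closedBlock (a b : ℝ)
      (h : I.carrier = {p | p.x ≤ b ∧ a ≤ p.y})

end Persistence

end

/-! A matching gives an interleaving by taking direct sums: matched intervals contribute their own
interleavings, and unmatched ones are sent to zero, which is correct because they are `2ε`-trivial.

For the converse, write the interleaving morphisms as scalar matrices `F`, `G` over the two barcodes
(`BarcodeBasis.exists_matrix`). A nonzero entry forces a nonzero morphism between blocks, which
either lowers the rank of the kind or keeps the kind and moves each end point up by at most `ε`
(`HomRel.rank_lt_or_shiftLE`). Order the blocks by `BlockCode.key`. If `F i j * G j l ≠ 0` and the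
key of `i` is at most that of `l`, then all three blocks have the same kind, and `j` is `ε`-close to
`i` or to `l`, since otherwise the key would drop from `i` to `l` (`ShiftLE.key_lt`).

Hence, for a finite set `S` of blocks that are not `2ε`-trivial, the part of `F * G` that factors
through the blocks close to `S` is block triangular with identity diagonal blocks. It is invertible,
so `S` has at least `S.card` close blocks (`Matrix.card_le_card_of_mul_triangular`). This is Hall's
condition, and it yields an injection from the nontrivial blocks of each module into the blocks of
the other. A Schröder–Bernstein argument merges the two injections (`PEquiv.exists_of_injective`),
and close blocks are interleaved by canonical morphisms. -/

noncomputable section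

namespace Persistence

/-! ### Bases adapted to a barcode. -/

section BarcodeBasis

variable {P : Type v} [PartialOrder P] {k : Type u} [Field k]

/-- A pointwise basis of a persistence module that exhibits the family of intervals `A` as its
barcode: `vec i p` generates the `i`-th summand at `p` (it is zero if `p ∉ A i`), and `coord i p`
is the corresponding coordinate. -/
structure BarcodeBasis {ι : Type*} (M : P ⥤ ModuleCat.{w} k) (A : ι → PosetInterval P) where
  vec : ι → ∀ p, M.obj p
  coord : ι → ∀ p, M.obj p →ₗ[k] k
  vec_of_notMem : ∀ {i p}, p ∉ (A i).carrier → vec i p = 0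
  coord_of_notMem : ∀ {i p}, p ∉ (A i).carrier → coord i p = 0
  coord_vec_self : ∀ {i p}, p ∈ (A i).carrier → coord i p (vec i p) = 1
  coord_vec_of_ne : ∀ {i j} p, i ≠ j → coord i p (vec j p) = 0
  map_vec : ∀ {i p q} (h : p ⟶ q), p ∈ (A i).carrier → (M.map h).hom (vec i p) = vec i q
  coord_map : ∀ {i p q} (h : p ⟶ q) (m : M.obj p), q ∈ (A i).carrier →
    coord i q ((M.map h).hom m) = coord i p m
  sum_coord : ∀ {p} (Z : Finset ι), (∀ i, p ∈ (A i).carrier → i ∈ Z) → ∀ m : M.obj p,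
    ∑ i ∈ Z, coord i p m • vec i p = m

open Classical in
theorem IsBarcode.nonempty_basis {ι : Type*} {M : P ⥤ ModuleCat.{w} k} {A : ι → PosetInterval P}
    (h : IsBarcode M A) : Nonempty (BarcodeBasis M A) := by
  obtain ⟨e, he⟩ := h
  let one (i : ι) (p : P) : intervalSpace k (A i) p :=
    ⟨if p ∈ (A i).carrier then 1 else 0, fun hp => if_neg hp⟩
  have one_mem : ∀ {i p}, p ∈ (A i).carrier → (one i p : k) = 1 := fun hp => if_pos hp
  have one_notMem : ∀ {i p}, p ∉ (A i).carrier → one i p = 0 := fun hp =>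
    Subtype.ext (if_neg hp)
  let L (p : P) (i : ι) : intervalSpace k (A i) p →ₗ[k]
      (⨁ i, (intervalModule k (A i)).obj p) :=
    DirectSum.lof k ι (fun i => (intervalModule k (A i)).obj p) i
  let C (p : P) (i : ι) : (⨁ i, (intervalModule k (A i)).obj p) →ₗ[k] k :=
    (intervalSpace k (A i) p).subtype ∘ₗ
      DirectSum.component k ι (fun i => (intervalModule k (A i)).obj p) i
  have C_apply : ∀ p i (x : ⨁ i, (intervalModule k (A i)).obj p),
      C p i x = (intervalSpace k (A i) p).subtype (x i) := fun _ _ _ => rfl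
  have CL_self : ∀ p i (x : intervalSpace k (A i) p), C p i (L p i x) = x := by
    intro p i x
    exact congrArg Subtype.val (DirectSum.component.lof_self k
      (M := fun i => (intervalModule k (A i)).obj p) i x)
  have CL_ne : ∀ p i j (x : intervalSpace k (A j) p), i ≠ j → C p i (L p j x) = 0 := by
    intro p i j x hij
    have : (L p j x) i = 0 := DFinsupp.single_eq_of_ne hij
    rw [C_apply, this]; rfl
  have ext_C : ∀ p (x y : ⨁ i, (intervalModule k (A i)).obj p),
      (∀ i, C p i x = C p i y) → x = y := by
    intro p x y hxy
    exact DFinsupp.ext fun i => Subtype.ext (hxy i)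
  refine ⟨{
    vec := fun i p => (e p).symm (L p i (one i p))
    coord := fun i p => C p i ∘ₗ (e p).toLinearMap
    vec_of_notMem := ?_
    coord_of_notMem := ?_
    coord_vec_self := ?_
    coord_vec_of_ne := ?_
    map_vec := ?_
    coord_map := ?_
    sum_coord := ?_ }⟩
  · intro i p hp
    rw [one_notMem hp, map_zero, map_zero]
  · intro i p hp
    ext m
    exact (e p m i).2 hp
  · intro i p hp
    simp only [LinearMap.comp_apply, LinearEquiv.coe_coe, LinearEquiv.apply_symm_apply]
    rw [CL_self, one_mem hp]
  · intro i j p hij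
    simp only [LinearMap.comp_apply, LinearEquiv.coe_coe, LinearEquiv.apply_symm_apply]
    exact CL_ne _ _ _ _ hij
  · intro i p q f hp
    apply (e q).injective
    rw [he, LinearEquiv.apply_symm_apply, LinearEquiv.apply_symm_apply]
    refine (DirectSum.lmap_lof (M := fun i => (intervalModule k (A i)).obj p)
      (N := fun i => (intervalModule k (A i)).obj q) _ i (one i p)).trans (congrArg (L q i) (Subtype.ext ?_))
    change (if q ∈ (A i).carrier then (one i p : k) else 0) = if q ∈ (A i).carrier then 1 else 0
    rw [one_mem hp]
  · intro i p q f m hq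
    simp only [LinearMap.comp_apply, LinearEquiv.coe_coe]
    rw [he, C_apply, DirectSum.lmap_apply, C_apply]
    exact intervalMap_coe_of_mem k (A i) hq _
  · intro p Z hZ m
    apply (e p).injective
    rw [map_sum]
    apply ext_C
    intro j
    rw [map_sum]
    simp only [map_smul, LinearEquiv.apply_symm_apply, LinearMap.comp_apply,
      LinearEquiv.coe_coe]
    by_cases hj : p ∈ (A j).carrier
    · rw [Finset.sum_eq_single_of_mem j (hZ j hj), CL_self, one_mem hj, smul_eq_mul, mul_one]
      intro i _ hij
      rw [CL_ne _ _ _ _ hij.symm, smul_zero]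
    · have h0 : ∀ x, C p j x = 0 := fun x => (x j).2 hj
      simp only [h0, smul_zero, Finset.sum_const_zero]

/-- Pointwise finiteness enters the argument here: the generators alive at `p` are linearly
independent. Sums over blocks containing a point and the neighbourhoods in Hall's theorem are finite
for this reason. -/
theorem BarcodeBasis.finite_mem {ι : Type*} {M : P ⥤ ModuleCat.{w} k} {A : ι → PosetInterval P}
    (b : BarcodeBasis M A) (hM : IsPFD M) (p : P) : {i | p ∈ (A i).carrier}.Finite := by
  have : Module.Finite k (M.obj p) := hM p
  have hli : LinearIndependent k
      (fun i : {i | p ∈ (A i).carrier} => b.vec i.1 p) := by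
    rw [linearIndependent_iff']
    intro s g hg i hi
    have h := congrArg (b.coord i.1 p) hg
    rw [map_sum, map_zero, Finset.sum_eq_single_of_mem i hi, map_smul, b.coord_vec_self i.2,
      smul_eq_mul, mul_one] at h
    · exact h
    · intro j _ hji
      rw [map_smul, b.coord_vec_of_ne p (fun h => hji (Subtype.ext h.symm)), smul_zero]
  exact hli.finite

end BarcodeBasis

/-! ### Morphisms as matrices. -/

section Coefficients

variable {k : Type u} [Field k]

/-- There is a nonzero morphism from the interval module of `I` to the `ε`-shift of that of `J`,
expressed through the sets. -/
def HomRel (ε : ℝ≥0) (I J : Set 𝕌) : Prop :=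
  (∀ p q, p ≤ q → p ∈ I → 𝕌.shift ε q ∈ J → (𝕌.shift ε p ∈ J ↔ q ∈ I)) ∧
    ∃ r ∈ I, 𝕌.shift ε r ∈ J

/-- The join of two points. -/
def 𝕌.join (p q : 𝕌) : 𝕌 :=
  ⟨(OrderDual.toDual (min p.x q.x), max p.y q.y),
    (min_le_left _ _).trans (p.x_le_y.trans (le_max_left _ _))⟩

theorem 𝕌.le_join_left (p q : 𝕌) : p ≤ p.join q :=
  𝕌.le_iff.2 ⟨min_le_left _ _, le_max_left _ _⟩

theorem 𝕌.le_join_right (p q : 𝕌) : q ≤ p.join q :=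
  𝕌.le_iff.2 ⟨min_le_right _ _, le_max_right _ _⟩

theorem 𝕌.shift_join (ε : ℝ≥0) (p q : 𝕌) :
    𝕌.shift ε (p.join q) = (𝕌.shift ε p).join (𝕌.shift ε q) :=
  Subtype.ext (Prod.ext (min_sub_sub_right p.x q.x (ε : ℝ)).symm
    (max_add_add_right p.y q.y (ε : ℝ)).symm)

/-- Sets that contain the joins of their elements. -/
def JoinClosed (I : Set 𝕌) : Prop :=
  ∀ p ∈ I, ∀ q ∈ I, p.join q ∈ I

variable {ι : Type v} {κ : Type v'} {M N : 𝕌 ⥤ ModuleCat.{w} k}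
  {A : ι → PosetInterval 𝕌} {B : κ → PosetInterval 𝕌}

/-- With respect to barcode bases, a morphism `M ⟶ N(ε)` is given by a matrix of scalars whose
nonzero entries belong to pairs of intervals with a nonzero morphism. -/
theorem BarcodeBasis.exists_matrix (b : BarcodeBasis M A) (c : BarcodeBasis N B)
    (hB : ∀ j, JoinClosed (B j).carrier) {ε : ℝ≥0}
    (f : M ⟶ shiftModule ε N) :
    ∃ F : ι → κ → k, (∀ i j, F i j ≠ 0 → HomRel ε (A i).carrier (B j).carrier) ∧
      ∀ i j p, p ∈ (A i).carrier → 𝕌.shift ε p ∈ (B j).carrier →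
        c.coord j (𝕌.shift ε p) ((f.app p).hom (b.vec i p)) = F i j := by
  classical
  let φ (i : ι) (j : κ) (p : 𝕌) : k := c.coord j (𝕌.shift ε p) ((f.app p).hom (b.vec i p))
  -- Naturality. Neither `q ∈ A i` nor `shift ε p ∈ B j` is required: a coefficient outside the
  -- supports is zero, and this is what later gives both directions of `HomRel`.
  have hle : ∀ i j p q, p ≤ q → p ∈ (A i).carrier → 𝕌.shift ε q ∈ (B j).carrier →
      φ i j p = φ i j q := by
    intro i j p q hpq hp hq
    have h1 : (f.app q).hom ((M.map (homOfLE hpq)).hom (b.vec i p)) =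
        (N.map (homOfLE (𝕌.shift_mono ε hpq))).hom ((f.app p).hom (b.vec i p)) :=
      congrArg (fun g => g.hom (b.vec i p)) (f.naturality (homOfLE hpq))
    rw [b.map_vec _ hp] at h1
    change _ = c.coord j (𝕌.shift ε q) ((f.app q).hom (b.vec i q))
    rw [h1]
    exact (c.coord_map (homOfLE (𝕌.shift_mono ε hpq)) _ hq).symm
  have hmem : ∀ i j p, φ i j p ≠ 0 → p ∈ (A i).carrier ∧ 𝕌.shift ε p ∈ (B j).carrier := by
    intro i j p h
    constructor
    · by_contra hp
      apply h
      change c.coord j (𝕌.shift ε p) ((f.app p).hom (b.vec i p)) = 0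
      rw [b.vec_of_notMem hp, map_zero]
      exact map_zero (c.coord j (𝕌.shift ε p))
    · by_contra hp
      apply h
      change c.coord j (𝕌.shift ε p) ((f.app p).hom (b.vec i p)) = 0
      rw [c.coord_of_notMem hp]
      rfl
  have hconst : ∀ i j p q, p ∈ (A i).carrier → 𝕌.shift ε p ∈ (B j).carrier →
      q ∈ (A i).carrier → 𝕌.shift ε q ∈ (B j).carrier → φ i j p = φ i j q := by
    -- Both coefficients equal the one at the join. The join itself may leave `A i`; only its shift
    -- has to stay in `B j`.
    intro i j p q hp hp' hq hq'
    have h := hB j _ hp' _ hq'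
    rw [← 𝕌.shift_join] at h
    exact (hle i j _ _ (𝕌.le_join_left p q) hp h).trans
      (hle i j _ _ (𝕌.le_join_right p q) hq h).symm
  have hF : ∀ i j, ∃ s : k, (s ≠ 0 → ∃ r ∈ (A i).carrier, 𝕌.shift ε r ∈ (B j).carrier) ∧
      ∀ p, p ∈ (A i).carrier → 𝕌.shift ε p ∈ (B j).carrier → φ i j p = s := by
    intro i j
    by_cases h : ∃ r ∈ (A i).carrier, 𝕌.shift ε r ∈ (B j).carrier
    · obtain ⟨r, hr, hr'⟩ := h
      exact ⟨φ i j r, fun _ => ⟨r, hr, hr'⟩, fun p hp hp' => hconst i j p r hp hp' hr hr'⟩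
    · exact ⟨0, fun h0 => absurd rfl h0, fun p hp hp' => absurd ⟨p, hp, hp'⟩ h⟩
  choose F hF1 hF2 using hF
  refine ⟨F, fun i j hij => ⟨fun p q hpq hp hq => ?_, hF1 i j hij⟩, hF2⟩
  have h := hle i j p q hpq hp hq
  constructor
  · intro hp'
    rw [hF2 i j p hp hp'] at h
    exact (hmem i j q (h ▸ hij)).1
  · intro hq'
    rw [hF2 i j q hq' hq] at h
    exact (hmem i j p (h.symm ▸ hij)).2

open Classical in
/-- The matrices of two morphisms `M ⟶ N(ε)` and `N ⟶ M(ε)` whose composite is given by the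
internal maps of `M` multiply to the identity wherever this is visible. -/
theorem BarcodeBasis.sum_mul_eq (b : BarcodeBasis M A) (c : BarcodeBasis N B) {ε : ℝ≥0}
    (f : M ⟶ shiftModule ε N) (g : N ⟶ shiftModule ε M)
    (hfg : ∀ p, f.app p ≫ g.app (𝕌.shift ε p) =
      M.map (homOfLE ((𝕌.le_shift ε p).trans (𝕌.le_shift ε (𝕌.shift ε p)))))
    {F : ι → κ → k} {G : κ → ι → k}
    (hF : ∀ i j p, p ∈ (A i).carrier → 𝕌.shift ε p ∈ (B j).carrier →
      c.coord j (𝕌.shift ε p) ((f.app p).hom (b.vec i p)) = F i j)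
    (hG : ∀ j i p, p ∈ (B j).carrier → 𝕌.shift ε p ∈ (A i).carrier →
      b.coord i (𝕌.shift ε p) ((g.app p).hom (c.vec j p)) = G j i)
    {i l : ι} {p : 𝕌} (Z : Finset κ) (hZ : ∀ j, j ∈ Z ↔ 𝕌.shift ε p ∈ (B j).carrier)
    (hp : p ∈ (A i).carrier) (hp' : 𝕌.shift ε (𝕌.shift ε p) ∈ (A l).carrier) :
    ∑ j ∈ Z, F i j * G j l = if i = l then 1 else 0 := by
  have h : (g.app (𝕌.shift ε p)).hom ((f.app p).hom (b.vec i p)) =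
      (M.map (homOfLE ((𝕌.le_shift ε p).trans (𝕌.le_shift ε (𝕌.shift ε p))))).hom
        (b.vec i p) := congrArg (fun g => g.hom (b.vec i p)) (hfg p)
  have hs : ∑ j ∈ Z, c.coord j (𝕌.shift ε p) ((f.app p).hom (b.vec i p)) •
      c.vec j (𝕌.shift ε p) = (f.app p).hom (b.vec i p) :=
    c.sum_coord Z (fun j hj => (hZ j).2 hj) _
  rw [b.map_vec _ hp, ← hs] at h
  have h2 := congrArg (b.coord l (𝕌.shift ε (𝕌.shift ε p))) h
  have h3 : b.coord l (𝕌.shift ε (𝕌.shift ε p))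
      ((g.app (𝕌.shift ε p)).hom (∑ j ∈ Z, c.coord j (𝕌.shift ε p) ((f.app p).hom (b.vec i p)) •
      c.vec j (𝕌.shift ε p))) = ∑ j ∈ Z, F i j * G j l := by
    rw [map_sum]
    refine (map_sum (b.coord l (𝕌.shift ε (𝕌.shift ε p))) _ _).trans ?_
    refine Finset.sum_congr rfl fun j hj => ?_
    rw [map_smul]
    refine (map_smul (b.coord l (𝕌.shift ε (𝕌.shift ε p))) _ _).trans ?_
    rw [hF i j p hp ((hZ j).1 hj), hG j l _ ((hZ j).1 hj) hp', smul_eq_mul]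
  rw [← h3, h2]
  split_ifs with hil
  · subst hil
    exact b.coord_vec_self hp'
  · exact b.coord_vec_of_ne _ (Ne.symm hil)

end Coefficients

end Persistence

/-! ### Blocks in the coordinates `s = -x`, `t = y`. -/

namespace Persistence

/-- The four kinds of blocks: open, open-closed, closed-open, closed. -/
inductive BlockKind
  | oo | oc | co | cc

/-- Nonzero morphisms between blocks of different kinds decrease the rank. -/
def BlockKind.rank : BlockKind → ℕ
  | oo => 0
  | oc => 1
  | co => 2
  | cc => 3

/-- A uniform description of blocks, in the coordinates `-x` and `y`. -/
structure BlockCode where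
  kind : BlockKind
  left : WithTop ℝ
  right : WithTop ℝ

/-- The block described by a code contains the point with the coordinates `s = -x` and `t = y`. -/
def BlockCode.Mem : BlockCode → ℝ → ℝ → Prop
  | ⟨.oo, u, v⟩, s, t => (s : WithTop ℝ) < u ∧ (t : WithTop ℝ) < v
  | ⟨.oc, u, v⟩, s, _ => u ≤ (s : WithTop ℝ) ∧ (s : WithTop ℝ) < v
  | ⟨.co, u, v⟩, _, t => u ≤ (t : WithTop ℝ) ∧ (t : WithTop ℝ) < v
  | ⟨.cc, u, v⟩, s, t => u ≤ (t : WithTop ℝ) ∧ v ≤ (s : WithTop ℝ)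

/-- The block described by a code. -/
def BlockCode.toSet (c : BlockCode) : Set 𝕌 :=
  {p | c.Mem (-p.x) p.y}

/-- The point with given coordinates `-x` and `y`. -/
def 𝕌.point (s t : ℝ) (h : 0 ≤ s + t) : 𝕌 :=
  ⟨(OrderDual.toDual (-s), t), neg_le_iff_add_nonneg'.2 h⟩

section Membership

variable {u v : WithTop ℝ} {p : 𝕌} {s t : ℝ} {ε : ℝ≥0}

theorem mem_oo : p ∈ BlockCode.toSet ⟨.oo, u, v⟩ ↔
    ((-p.x : ℝ) : WithTop ℝ) < u ∧ (p.y : WithTop ℝ) < v := Iff.rfl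

theorem mem_oc : p ∈ BlockCode.toSet ⟨.oc, u, v⟩ ↔
    u ≤ ((-p.x : ℝ) : WithTop ℝ) ∧ ((-p.x : ℝ) : WithTop ℝ) < v := Iff.rfl

theorem mem_co : p ∈ BlockCode.toSet ⟨.co, u, v⟩ ↔
    u ≤ (p.y : WithTop ℝ) ∧ (p.y : WithTop ℝ) < v := Iff.rfl

theorem mem_cc : p ∈ BlockCode.toSet ⟨.cc, u, v⟩ ↔
    u ≤ (p.y : WithTop ℝ) ∧ v ≤ ((-p.x : ℝ) : WithTop ℝ) := Iff.rfl

theorem 𝕌.point_x (h : 0 ≤ s + t) : (𝕌.point s t h).x = -s := rfl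

theorem 𝕌.point_y (h : 0 ≤ s + t) : (𝕌.point s t h).y = t := rfl

theorem 𝕌.shift_x : (𝕌.shift ε p).x = p.x - ε := rfl

theorem 𝕌.shift_y : (𝕌.shift ε p).y = p.y + ε := rfl

end Membership

/-- A code bounds `s` and `t` separately, and a join takes the maximum in each coordinate. -/
theorem BlockCode.joinClosed (c : BlockCode) : JoinClosed c.toSet := by
  have hx : ∀ p q : 𝕌, -(p.join q).x = max (-p.x) (-q.x) := fun p q =>
    (max_neg_neg p.x q.x).symm
  have hy : ∀ p q : 𝕌, (p.join q).y = max p.y q.y := fun p q => rfl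
  obtain ⟨κ, u, v⟩ := c
  intro p hp q hq
  cases κ
  · rw [mem_oo] at *
    rw [hx, hy, WithTop.coe_max, WithTop.coe_max]
    exact ⟨max_lt hp.1 hq.1, max_lt hp.2 hq.2⟩
  · rw [mem_oc] at *
    rw [hx, WithTop.coe_max]
    exact ⟨le_max_of_le_left hp.1, max_lt hp.2 hq.2⟩
  · rw [mem_co] at *
    rw [hy, WithTop.coe_max]
    exact ⟨le_max_of_le_left hp.1, max_lt hp.2 hq.2⟩
  · rw [mem_cc] at *
    rw [hx, hy, WithTop.coe_max, WithTop.coe_max]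
    exact ⟨le_max_of_le_left hp.1, le_max_of_le_left hp.2⟩

theorem EReal.exists_withTop_lt_iff {b : EReal} (hb : b ≠ ⊥) :
    ∃ v : WithTop ℝ, ∀ y : ℝ, (y : EReal) < b ↔ (y : WithTop ℝ) < v := by
  induction b with
  | bot => exact absurd rfl hb
  | coe b => exact ⟨b, fun y => by rw [EReal.coe_lt_coe_iff, WithTop.coe_lt_coe]⟩
  | top => exact ⟨⊤, fun y => ⟨fun _ => WithTop.coe_lt_top y, fun _ => EReal.coe_lt_top y⟩⟩

/-- With `-x` in place of `x`, an end point can be infinite only as `⊤`: the condition `a < b`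
excludes the other infinity. So `WithTop ℝ` suffices. -/
theorem IsBlock.exists_code {I : PosetInterval 𝕌} (hI : IsBlock I) :
    ∃ c : BlockCode, I.carrier = c.toSet := by
  have neg_lt : ∀ (a : EReal) (x : ℝ), a < x ↔ ((-x : ℝ) : EReal) < -a := fun a x => by
    rw [EReal.coe_neg, EReal.neg_lt_neg_iff]
  cases hI with
  | openBlock a b hab h =>
    obtain ⟨u, hu⟩ := EReal.exists_withTop_lt_iff (b := -a)
      (fun h => (hab.trans_le le_top).ne (EReal.neg_eq_bot_iff.1 h))
    obtain ⟨v, hv⟩ := EReal.exists_withTop_lt_iff (b := b) (bot_le.trans_lt hab).ne'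
    refine ⟨⟨.oo, u, v⟩, h.trans (Set.ext fun p => ?_)⟩
    rw [mem_oo, ← hu, ← hv, ← neg_lt]
    rfl
  | closedOpenBlock a b hab h =>
    obtain ⟨v, hv⟩ := EReal.exists_withTop_lt_iff (b := b) (bot_le.trans_lt hab).ne'
    refine ⟨⟨.co, a, v⟩, h.trans (Set.ext fun p => ?_)⟩
    rw [mem_co, ← hv, WithTop.coe_le_coe]
    rfl
  | openClosedBlock a b hab h =>
    obtain ⟨v, hv⟩ := EReal.exists_withTop_lt_iff (b := -a)
      (fun h => (hab.trans_le le_top).ne (EReal.neg_eq_bot_iff.1 h))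
    refine ⟨⟨.oc, (-b : ℝ), v⟩, h.trans (Set.ext fun p => ?_)⟩
    rw [mem_oc, ← hv, WithTop.coe_le_coe, ← neg_lt, neg_le_neg_iff]
    exact and_comm
  | closedBlock a b h =>
    refine ⟨⟨.cc, a, (-b : ℝ)⟩, h.trans (Set.ext fun p => ?_)⟩
    rw [mem_cc, WithTop.coe_le_coe, WithTop.coe_le_coe, neg_le_neg_iff]
    exact and_comm

/-- The relation between codes of the same kind that comes with a nonzero morphism from the one
block to the `ε`-shift of the other. -/
structure ShiftLE (ε : ℝ) (c d : BlockCode) : Prop where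
  kind : d.kind = c.kind
  left : d.left ≤ c.left + ε
  right : d.right ≤ c.right + ε

theorem ShiftLE.trans {ε δ : ℝ} {c d e : BlockCode} (h : ShiftLE ε c d) (h' : ShiftLE δ d e) :
    ShiftLE (ε + δ) c e := by
  refine ⟨h'.kind.trans h.kind, ?_, ?_⟩
  · rw [WithTop.coe_add, ← add_assoc]
    exact h'.left.trans (add_le_add_left h.left _)
  · rw [WithTop.coe_add, ← add_assoc]
    exact h'.right.trans (add_le_add_left h.right _)

theorem WithTop.lt_of_le_add {u u' : WithTop ℝ} {ε s : ℝ} (h : u' ≤ u + ε)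
    (h' : ((s + ε : ℝ) : WithTop ℝ) < u') : (s : WithTop ℝ) < u := by
  induction u using WithTop.recTopCoe with
  | top => exact WithTop.coe_lt_top s
  | coe u =>
    have := h'.trans_le h
    norm_cast at *
    linarith

theorem WithTop.le_add_of_le {u u' : WithTop ℝ} {ε s : ℝ} (h : u' ≤ u + ε)
    (h' : u ≤ (s : WithTop ℝ)) : u' ≤ ((s + ε : ℝ) : WithTop ℝ) := by
  rw [WithTop.coe_add]
  exact h.trans (add_le_add_left h' _)

theorem WithTop.le_add_of_forall {u u' : WithTop ℝ} {ε : ℝ}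
    (h : ∀ s : ℝ, u ≤ s → u' ≤ ((s + ε : ℝ) : WithTop ℝ)) : u' ≤ u + ε := by
  induction u using WithTop.recTopCoe with
  | top => rw [WithTop.top_add]; exact le_top
  | coe u => exact_mod_cast h u le_rfl

theorem 𝕌.shift_neg_x (ε : ℝ≥0) (p : 𝕌) : -(𝕌.shift ε p).x = -p.x + ε := by
  rw [𝕌.shift_x]; ring

/-- The condition under which the canonical map between blocks of the same kind is natural. -/
theorem ShiftLE.mem_and_mem {ε : ℝ≥0} {c d : BlockCode} (h : ShiftLE ε c d) {p q : 𝕌}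
    (hpq : p ≤ q) (hp : p ∈ c.toSet) (hq : 𝕌.shift ε q ∈ d.toSet) :
    𝕌.shift ε p ∈ d.toSet ∧ q ∈ c.toSet := by
  obtain ⟨κ, u, v⟩ := c
  obtain ⟨κ', u', v'⟩ := d
  obtain ⟨hk, hu, hv⟩ := h
  dsimp only at hk hu hv
  subst hk
  obtain ⟨h1, h2⟩ := 𝕌.le_iff.1 hpq
  have h1' : ((-p.x + ε : ℝ) : WithTop ℝ) ≤ ((-q.x + ε : ℝ) : WithTop ℝ) :=
    WithTop.coe_le_coe.2 (by linarith)
  have h2' : ((p.y + ε : ℝ) : WithTop ℝ) ≤ ((q.y + ε : ℝ) : WithTop ℝ) :=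
    WithTop.coe_le_coe.2 (by linarith)
  have h1'' : ((-p.x : ℝ) : WithTop ℝ) ≤ ((-q.x : ℝ) : WithTop ℝ) :=
    WithTop.coe_le_coe.2 (by linarith)
  have h2'' : (p.y : WithTop ℝ) ≤ (q.y : WithTop ℝ) := WithTop.coe_le_coe.2 (by linarith)
  cases κ'
  · rw [mem_oo] at *
    rw [𝕌.shift_neg_x, 𝕌.shift_y] at *
    exact ⟨⟨h1'.trans_lt hq.1, h2'.trans_lt hq.2⟩,
      WithTop.lt_of_le_add hu hq.1, WithTop.lt_of_le_add hv hq.2⟩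
  · rw [mem_oc] at *
    rw [𝕌.shift_neg_x] at *
    exact ⟨⟨WithTop.le_add_of_le hu hp.1, h1'.trans_lt hq.2⟩,
      hp.1.trans h1'', WithTop.lt_of_le_add hv hq.2⟩
  · rw [mem_co] at *
    rw [𝕌.shift_y] at *
    exact ⟨⟨WithTop.le_add_of_le hu hp.1, h2'.trans_lt hq.2⟩,
      hp.1.trans h2'', WithTop.lt_of_le_add hv hq.2⟩
  · rw [mem_cc] at *
    rw [𝕌.shift_neg_x, 𝕌.shift_y] at *
    exact ⟨⟨WithTop.le_add_of_le hu hp.1, WithTop.le_add_of_le hv hp.2⟩,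
      hp.1.trans h2'', hp.2.trans h1''⟩

/-- Lower bounds on the midpoint come from `p` through the first relation, strict upper bounds from
the double shift through the second. Thus the middle block is alive whenever the outer two are. -/
theorem ShiftLE.shift_mem {ε : ℝ≥0} {c d e : BlockCode} (h : ShiftLE ε c d) (h' : ShiftLE ε d e)
    {p : 𝕌} (hp : p ∈ c.toSet) (hp' : 𝕌.shift ε (𝕌.shift ε p) ∈ e.toSet) :
    𝕌.shift ε p ∈ d.toSet := by
  obtain ⟨κ, u, v⟩ := c
  obtain ⟨κ', u', v'⟩ := d
  obtain ⟨κ'', u'', v''⟩ := e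
  obtain ⟨hk, hu, hv⟩ := h
  obtain ⟨hk', hu', hv'⟩ := h'
  dsimp only at hk hu hv hk' hu' hv'
  subst hk hk'
  cases κ''
  · rw [mem_oo, 𝕌.shift_neg_x _ (𝕌.shift ε p), 𝕌.shift_y (p := 𝕌.shift ε p)] at hp'
    exact ⟨WithTop.lt_of_le_add hu' hp'.1, WithTop.lt_of_le_add hv' hp'.2⟩
  · rw [mem_oc, 𝕌.shift_neg_x _ (𝕌.shift ε p)] at hp'
    rw [mem_oc] at hp
    refine ⟨?_, WithTop.lt_of_le_add hv' hp'.2⟩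
    rw [𝕌.shift_neg_x]
    exact WithTop.le_add_of_le hu hp.1
  · rw [mem_co, 𝕌.shift_y (p := 𝕌.shift ε p)] at hp'
    rw [mem_co] at hp
    exact ⟨WithTop.le_add_of_le hu hp.1, WithTop.lt_of_le_add hv' hp'.2⟩
  · rw [mem_cc] at hp ⊢
    rw [𝕌.shift_neg_x]
    exact ⟨WithTop.le_add_of_le hu hp.1, WithTop.le_add_of_le hv hp.2⟩

end Persistence

/-! ### Nonzero morphisms between blocks. -/

namespace Persistence

section HomRel

variable {ε : ℝ≥0} {u v u' v' : WithTop ℝ}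

/-- The relation `HomRel` between blocks, in coordinates. -/
def CoordHomRel (ε : ℝ) (c d : BlockCode) : Prop :=
  (∀ s t s' t', 0 ≤ s + t → s ≤ s' → t ≤ t' → c.Mem s t → d.Mem (s' + ε) (t' + ε) →
    (d.Mem (s + ε) (t + ε) ↔ c.Mem s' t')) ∧
  ∃ s t, 0 ≤ s + t ∧ c.Mem s t ∧ d.Mem (s + ε) (t + ε)

theorem 𝕌.point_mem {c : BlockCode} {s t : ℝ} (h : 0 ≤ s + t) :
    𝕌.point s t h ∈ c.toSet ↔ c.Mem s t := by
  change c.Mem (- -s) t ↔ _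
  rw [neg_neg]

theorem 𝕌.shift_mem {c : BlockCode} {p : 𝕌} :
    𝕌.shift ε p ∈ c.toSet ↔ c.Mem (-p.x + ε) (p.y + ε) := by
  change c.Mem (-(𝕌.shift ε p).x) _ ↔ _
  rw [𝕌.shift_neg_x]
  rfl

theorem 𝕌.shift_point_mem {c : BlockCode} {s t : ℝ} (h : 0 ≤ s + t) :
    𝕌.shift ε (𝕌.point s t h) ∈ c.toSet ↔ c.Mem (s + ε) (t + ε) := by
  rw [𝕌.shift_mem, 𝕌.point_x, 𝕌.point_y, neg_neg]

theorem HomRel.coord {c d : BlockCode} (h : HomRel ε c.toSet d.toSet) : CoordHomRel ε c d := by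
  obtain ⟨h, r, hr, hr'⟩ := h
  refine ⟨fun s t s' t' h0 hs ht hc hd => ?_, -r.x, r.y, ?_, hr, 𝕌.shift_mem.1 hr'⟩
  · have h0' : 0 ≤ s' + t' := by linarith
    have := h (𝕌.point s t h0) (𝕌.point s' t' h0') (𝕌.le_iff.2 ⟨neg_le_neg hs, ht⟩)
      ((𝕌.point_mem h0).2 hc) ((𝕌.shift_point_mem h0').2 hd)
    rwa [𝕌.shift_point_mem, 𝕌.point_mem] at this
  · linarith [r.x_le_y]

/-- If an end point of the target were too far up, a point of the source could be moved past the end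
of its block while its shift stays in the target, against the equivalence in `CoordHomRel`. -/
theorem CoordHomRel.oo_oo {ε : ℝ} (h : CoordHomRel ε ⟨.oo, u, v⟩ ⟨.oo, u', v'⟩) :
    u' ≤ u + ε ∧ v' ≤ v + ε := by
  obtain ⟨h, s, t, h0, hc, hd⟩ := h
  constructor <;> refine WithTop.le_add_of_forall fun a ha => ?_ <;> by_contra! hlt
  · have hs : s ≤ a := WithTop.coe_le_coe.1 (hc.1.le.trans ha)
    exact (((h s t a t h0 hs le_rfl hc ⟨hlt, hd.2⟩).1 hd).1.trans_le ha).false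
  · have ht : t ≤ a := WithTop.coe_le_coe.1 (hc.2.le.trans ha)
    exact (((h s t s a h0 le_rfl ht hc ⟨hd.1, hlt⟩).1 hd).2.trans_le ha).false

theorem CoordHomRel.co_co {ε : ℝ} (h : CoordHomRel ε ⟨.co, u, v⟩ ⟨.co, u', v'⟩) :
    u' ≤ u + ε ∧ v' ≤ v + ε := by
  obtain ⟨h, s, t, h0, hc, hd⟩ := h
  constructor <;> refine WithTop.le_add_of_forall fun a ha => ?_ <;> by_contra! hlt
  · have hat : a < t := by
      have := WithTop.coe_lt_coe.1 (hlt.trans_le hd.1)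
      linarith
    -- The coordinate `s` is unconstrained in these blocks, so it is enlarged to keep the lowered
    -- point in `𝕌`.
    have hs : 0 ≤ (|s| + |a|) + a := by linarith [neg_abs_le a, abs_nonneg s]
    exact (((h (|s| + |a|) a (|s| + |a|) t hs le_rfl hat.le
      ⟨ha, (WithTop.coe_lt_coe.2 hat).trans hc.2⟩ hd).2 hc).1.trans_lt hlt).false
  · have ht : t ≤ a := WithTop.coe_le_coe.1 (hc.2.le.trans ha)
    exact (((h s t s a h0 le_rfl ht hc
      ⟨hd.1.trans (WithTop.coe_le_coe.2 (by linarith)), hlt⟩).1 hd).2.trans_le ha).false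

theorem CoordHomRel.oc_oc {ε : ℝ} (h : CoordHomRel ε ⟨.oc, u, v⟩ ⟨.oc, u', v'⟩) :
    u' ≤ u + ε ∧ v' ≤ v + ε := by
  refine CoordHomRel.co_co ⟨fun s t s' t' h0 hs ht hc hd => ?_, ?_⟩
  · exact h.1 t s t' s' (by linarith) ht hs hc hd
  · obtain ⟨_, s, t, h0, hc, hd⟩ := h
    exact ⟨t, s, by linarith, hc, hd⟩

theorem CoordHomRel.cc_cc {ε : ℝ} (h : CoordHomRel ε ⟨.cc, u, v⟩ ⟨.cc, u', v'⟩) :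
    u' ≤ u + ε ∧ v' ≤ v + ε := by
  obtain ⟨h, s, t, h0, hc, hd⟩ := h
  -- Closed blocks are upward closed, so the maximum with the witness lies in both supports;
  -- comparing with it shows that the shift maps the source block into the target.
  have key : ∀ a b, 0 ≤ a + b → BlockCode.Mem ⟨.cc, u, v⟩ a b →
      BlockCode.Mem ⟨.cc, u', v'⟩ (a + ε) (b + ε) := by
    intro a b hab hm
    refine (h a b (max a s) (max b t) hab (le_max_left _ _) (le_max_left _ _) hm ⟨?_, ?_⟩).2
      ⟨?_, ?_⟩
    · exact hd.1.trans (WithTop.coe_le_coe.2 (by linarith [le_max_right b t]))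
    · exact hd.2.trans (WithTop.coe_le_coe.2 (by linarith [le_max_right a s]))
    · exact hm.1.trans (WithTop.coe_le_coe.2 (le_max_left _ _))
    · exact hm.2.trans (WithTop.coe_le_coe.2 (le_max_left _ _))
  constructor <;> refine WithTop.le_add_of_forall fun a ha => ?_
  · exact (key (|s| + |a|) a (by linarith [neg_abs_le a, abs_nonneg s])
      ⟨ha, hc.2.trans (WithTop.coe_le_coe.2 (by linarith [le_abs_self s, abs_nonneg a]))⟩).1
  · exact (key a (|t| + |a|) (by linarith [neg_abs_le a, abs_nonneg t])
      ⟨hc.1.trans (WithTop.coe_le_coe.2 (by linarith [le_abs_self t, abs_nonneg a])), ha⟩).2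

/-- Reflection in the diagonal preserves `0 ≤ s + t` and the order. It exchanges the kinds `oc` and
`co`, so only some of the exclusions need a direct proof. -/
theorem CoordHomRel.swap {ε : ℝ} {c c' d d' : BlockCode} (hc : ∀ s t, c'.Mem s t ↔ c.Mem t s)
    (hd : ∀ s t, d'.Mem s t ↔ d.Mem t s) (h : CoordHomRel ε c d) : CoordHomRel ε c' d' := by
  refine ⟨fun s t s' t' h0 hs ht hm hm' => ?_, ?_⟩
  · rw [hd, hc]
    exact h.1 t s t' s' (by linarith) ht hs ((hc _ _).1 hm) ((hd _ _).1 hm')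
  · obtain ⟨_, s, t, h0, hm, hm'⟩ := h
    exact ⟨t, s, by linarith, (hc _ _).2 hm, (hd _ _).2 hm'⟩

/-- The target has a lower end in `t` but no upper end in `s`. Raising `s` to `S` therefore keeps a
nonzero coefficient, and makes room in `𝕌` to lower `t` to `T`, below the lower end of the target.
The source is still alive at `T`, so naturality fails. The next three exclusions use the same two
moves. -/
theorem CoordHomRel.not_oo_co {ε : ℝ} : ¬ CoordHomRel ε ⟨.oo, u, v⟩ ⟨.co, u', v'⟩ := by
  rintro ⟨h, s, t, h0, hc, hd⟩
  obtain ⟨w, rfl⟩ := WithTop.ne_top_iff_exists.1 (hd.1.trans_lt (WithTop.coe_lt_top _)).ne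
  obtain ⟨T, hT, hT'⟩ : ∃ T, T ≤ t ∧ T + ε < w :=
    ⟨min t (w - ε) - 1, by linarith [min_le_left t (w - ε)], by linarith [min_le_right t (w - ε)]⟩
  obtain ⟨S, hS, hS'⟩ : ∃ S, s ≤ S ∧ 0 ≤ S + T :=
    ⟨max s (-T), le_max_left _ _, by linarith [le_max_right s (-T)]⟩
  have h1 := (h s t S t h0 hS le_rfl hc hd).1 hd
  have h2 := (h S T S t hS' le_rfl hT ⟨h1.1, (WithTop.coe_le_coe.2 hT).trans_lt h1.2⟩ hd).2 h1
  exact (WithTop.coe_le_coe.1 h2.1).not_gt hT'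

theorem CoordHomRel.not_oc_co {ε : ℝ} : ¬ CoordHomRel ε ⟨.oc, u, v⟩ ⟨.co, u', v'⟩ := by
  rintro ⟨h, s, t, h0, hc, hd⟩
  obtain ⟨w, rfl⟩ := WithTop.ne_top_iff_exists.1 (hd.1.trans_lt (WithTop.coe_lt_top _)).ne
  obtain ⟨T, hT, hT'⟩ : ∃ T, T ≤ t ∧ T + ε < w :=
    ⟨min t (w - ε) - 1, by linarith [min_le_left t (w - ε)], by linarith [min_le_right t (w - ε)]⟩
  obtain ⟨S, hS, hS'⟩ : ∃ S, s ≤ S ∧ 0 ≤ S + T :=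
    ⟨max s (-T), le_max_left _ _, by linarith [le_max_right s (-T)]⟩
  have h1 := (h s t S t h0 hS le_rfl hc hd).1 hd
  have h2 := (h S T S t hS' le_rfl hT h1 hd).2 h1
  exact (WithTop.coe_le_coe.1 h2.1).not_gt hT'

theorem CoordHomRel.not_oo_cc {ε : ℝ} : ¬ CoordHomRel ε ⟨.oo, u, v⟩ ⟨.cc, u', v'⟩ := by
  rintro ⟨h, s, t, h0, hc, hd⟩
  obtain ⟨w, rfl⟩ := WithTop.ne_top_iff_exists.1 (hd.1.trans_lt (WithTop.coe_lt_top _)).ne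
  obtain ⟨T, hT, hT'⟩ : ∃ T, T ≤ t ∧ T + ε < w :=
    ⟨min t (w - ε) - 1, by linarith [min_le_left t (w - ε)], by linarith [min_le_right t (w - ε)]⟩
  obtain ⟨S, hS, hS'⟩ : ∃ S, s ≤ S ∧ 0 ≤ S + T :=
    ⟨max s (-T), le_max_left _ _, by linarith [le_max_right s (-T)]⟩
  have hd' : BlockCode.Mem ⟨.cc, (w : WithTop ℝ), v'⟩ (S + ε) (t + ε) :=
    ⟨hd.1, hd.2.trans (WithTop.coe_le_coe.2 (by linarith))⟩
  have h1 := (h s t S t h0 hS le_rfl hc hd').1 hd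
  have h2 := (h S T S t hS' le_rfl hT ⟨h1.1, (WithTop.coe_le_coe.2 hT).trans_lt h1.2⟩ hd').2 h1
  exact (WithTop.coe_le_coe.1 h2.1).not_gt hT'

theorem CoordHomRel.not_oc_cc {ε : ℝ} : ¬ CoordHomRel ε ⟨.oc, u, v⟩ ⟨.cc, u', v'⟩ := by
  rintro ⟨h, s, t, h0, hc, hd⟩
  obtain ⟨w, rfl⟩ := WithTop.ne_top_iff_exists.1 (hd.1.trans_lt (WithTop.coe_lt_top _)).ne
  obtain ⟨T, hT, hT'⟩ : ∃ T, T ≤ t ∧ T + ε < w :=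
    ⟨min t (w - ε) - 1, by linarith [min_le_left t (w - ε)], by linarith [min_le_right t (w - ε)]⟩
  obtain ⟨S, hS, hS'⟩ : ∃ S, s ≤ S ∧ 0 ≤ S + T :=
    ⟨max s (-T), le_max_left _ _, by linarith [le_max_right s (-T)]⟩
  have hd' : BlockCode.Mem ⟨.cc, (w : WithTop ℝ), v'⟩ (S + ε) (t + ε) :=
    ⟨hd.1, hd.2.trans (WithTop.coe_le_coe.2 (by linarith))⟩
  have h1 := (h s t S t h0 hS le_rfl hc hd').1 hd
  have h2 := (h S T S t hS' le_rfl hT h1 hd').2 h1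
  exact (WithTop.coe_le_coe.1 h2.1).not_gt hT'

/-- A nonzero morphism between blocks lowers the rank of the kind, or relates blocks of the same
kind by `ShiftLE`. -/
theorem HomRel.rank_lt_or_shiftLE {c d : BlockCode} (h : HomRel ε c.toSet d.toSet) :
    d.kind.rank < c.kind.rank ∨ ShiftLE ε c d := by
  have h := h.coord
  obtain ⟨κ, u, v⟩ := c
  obtain ⟨κ', u', v'⟩ := d
  cases κ <;> cases κ'
  · exact .inr ⟨rfl, h.oo_oo.1, h.oo_oo.2⟩
  · exact absurd (h.swap (c := ⟨.oo, u, v⟩) (d := ⟨.oc, u', v'⟩) (c' := ⟨.oo, v, u⟩)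
      (d' := ⟨.co, u', v'⟩) (fun _ _ => and_comm) (fun _ _ => Iff.rfl)) CoordHomRel.not_oo_co
  · exact absurd h CoordHomRel.not_oo_co
  · exact absurd h CoordHomRel.not_oo_cc
  · exact .inl (by simp [BlockKind.rank])
  · exact .inr ⟨rfl, h.oc_oc.1, h.oc_oc.2⟩
  · exact absurd h CoordHomRel.not_oc_co
  · exact absurd h CoordHomRel.not_oc_cc
  · exact .inl (by simp [BlockKind.rank])
  · exact .inl (by simp [BlockKind.rank])
  · exact .inr ⟨rfl, h.co_co.1, h.co_co.2⟩
  · exact absurd (h.swap (c := ⟨.co, u, v⟩) (d := ⟨.cc, u', v'⟩) (c' := ⟨.oc, u, v⟩)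
      (d' := ⟨.cc, v', u'⟩) (fun _ _ => Iff.rfl) (fun _ _ => and_comm)) CoordHomRel.not_oc_cc
  · exact .inl (by simp [BlockKind.rank])
  · exact .inl (by simp [BlockKind.rank])
  · exact .inl (by simp [BlockKind.rank])
  · exact .inr ⟨rfl, h.cc_cc.1, h.cc_cc.2⟩

end HomRel

/-! ### The order on blocks. -/

section Key

/-- The number of infinite end points. -/
def BlockCode.infCount (c : BlockCode) : ℕ :=
  (if c.left = ⊤ then 1 else 0) + (if c.right = ⊤ then 1 else 0)

/-- Codes are ordered by kind, number of infinite end points, and sum of the finite end points. -/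
def BlockCode.key (c : BlockCode) : ℕ ×ₗ ℝ :=
  toLex (3 * c.kind.rank + c.infCount, c.left.untopD 0 + c.right.untopD 0)

theorem BlockCode.infCount_le (c : BlockCode) : c.infCount ≤ 2 := by
  unfold BlockCode.infCount
  split_ifs <;> norm_num

/-- The factor `3` in the key exceeds the largest `infCount`, so the rank dominates. -/
theorem BlockCode.rank_le_of_key_le {c d : BlockCode} (h : c.key ≤ d.key) :
    c.kind.rank ≤ d.kind.rank := by
  have h1 := c.infCount_le
  have h2 := d.infCount_le
  rcases Prod.Lex.toLex_le_toLex.1 h with h | h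
  · dsimp only at h; omega
  · have := h.1; dsimp only at this; omega

/-- `ShiftLE` never creates an infinite end point. If their number stays the same and the reverse
relation fails, one finite end point drops by more than `ε` while another finite one, if present,
rises by at most `ε`; so the sum of the finite end points decreases. -/
theorem ShiftLE.key_lt {ε : ℝ} {c d e : BlockCode} (h : ShiftLE ε c d) (h' : ShiftLE ε d e)
    (hdc : ¬ ShiftLE ε d c) (hed : ¬ ShiftLE ε e d) : e.key < c.key := by
  obtain ⟨κ, u, v⟩ := c
  obtain ⟨κ', u', v'⟩ := d
  obtain ⟨κ'', u'', v''⟩ := e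
  obtain ⟨hk, hu, hv⟩ := h
  obtain ⟨hk', hu', hv'⟩ := h'
  dsimp only at hk hu hv hk' hu' hv'
  subst hk hk'
  have hdc : u ≤ u' + ε → ¬ v ≤ v' + ε := fun h1 h2 => hdc ⟨rfl, h1, h2⟩
  have hed : u' ≤ u'' + ε → ¬ v' ≤ v'' + ε := fun h1 h2 => hed ⟨rfl, h1, h2⟩
  rw [BlockCode.key, BlockCode.key, Prod.Lex.toLex_lt_toLex]
  unfold BlockCode.infCount
  induction u using WithTop.recTopCoe <;> induction u' using WithTop.recTopCoe <;>
  induction u'' using WithTop.recTopCoe <;> induction v using WithTop.recTopCoe <;>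
  induction v' using WithTop.recTopCoe <;> induction v'' using WithTop.recTopCoe <;>
  simp at hu hu' hv hv' hdc hed ⊢ <;> norm_cast at * <;> grind

/-- If `w ≤ a + δ`, then `w` is finite, `b < a` and `w < v`, so either `v` is infinite or `a + v > b
+ w`; both contradict the order of the keys. -/
theorem BlockCode.add_lt_of_key_le {κ : BlockKind} {a b δ : ℝ} {v w : WithTop ℝ}
    (hkey : BlockCode.key ⟨κ, a, v⟩ ≤ BlockCode.key ⟨κ, b, w⟩)
    (hv : ((a + δ : ℝ) : WithTop ℝ) < v) (hw : ((b + δ : ℝ) : WithTop ℝ) < w) :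
    ((a + δ : ℝ) : WithTop ℝ) < w := by
  rw [BlockCode.key, BlockCode.key, Prod.Lex.toLex_le_toLex] at hkey
  unfold BlockCode.infCount at hkey
  induction v using WithTop.recTopCoe <;> induction w using WithTop.recTopCoe <;>
  simp at hkey <;> norm_cast at * <;> first | linarith | exact WithTop.coe_lt_top _

theorem 𝕌.shift_shift_mem {ε : ℝ≥0} {c : BlockCode} {p : 𝕌} :
    𝕌.shift ε (𝕌.shift ε p) ∈ c.toSet ↔ c.Mem (-p.x + (ε + ε)) (p.y + (ε + ε)) := by
  rw [𝕌.shift_mem, 𝕌.shift_neg_x, 𝕌.shift_y, add_assoc, add_assoc]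

/-- If `c` comes before `e` in the order of the keys, both blocks are not `2ε`-trivial, and the
end points allow a morphism, then this morphism is nonzero. -/
theorem ShiftLE.exists_mem {ε : ℝ≥0} {c e : BlockCode} (h : ShiftLE (ε + ε) c e)
    (hkey : c.key ≤ e.key)
    (hc : ∃ p ∈ c.toSet, 𝕌.shift ε (𝕌.shift ε p) ∈ c.toSet)
    (he : ∃ p ∈ e.toSet, 𝕌.shift ε (𝕌.shift ε p) ∈ e.toSet) :
    ∃ p ∈ c.toSet, 𝕌.shift ε (𝕌.shift ε p) ∈ e.toSet := by
  obtain ⟨κ, u, v⟩ := c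
  obtain ⟨κ', u', v'⟩ := e
  obtain ⟨hk, hu, hv⟩ := h
  dsimp only at hk hu hv
  subst hk
  obtain ⟨p, hp, hp'⟩ := hc
  obtain ⟨q, hq, hq'⟩ := he
  rw [𝕌.shift_shift_mem] at hp' hq'
  cases κ'
  · exact ⟨q, ⟨WithTop.lt_of_le_add hu hq'.1, WithTop.lt_of_le_add hv hq'.2⟩,
      𝕌.shift_shift_mem.2 hq'⟩
  · obtain ⟨a, rfl⟩ := WithTop.ne_top_iff_exists.1 (hp.1.trans_lt (WithTop.coe_lt_top _)).ne
    obtain ⟨b, rfl⟩ := WithTop.ne_top_iff_exists.1 (hq.1.trans_lt (WithTop.coe_lt_top _)).ne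
    have ha : a ≤ -p.x := WithTop.coe_le_coe.1 hp.1
    have hb : b ≤ -q.x := WithTop.coe_le_coe.1 hq.1
    have h1 : ((a + (ε + ε) : ℝ) : WithTop ℝ) < v :=
      (WithTop.coe_le_coe.2 (by linarith)).trans_lt hp'.2
    have h2 := BlockCode.add_lt_of_key_le hkey h1
      ((WithTop.coe_le_coe.2 (by linarith)).trans_lt hq'.2)
    have h0 : 0 ≤ a + |a| := by linarith [neg_abs_le a]
    -- The lower end `a` of the first block is the best candidate; the free coordinate `|a|` only
    -- ensures that the point lies in `𝕌`.
    refine ⟨𝕌.point a |a| h0, (𝕌.point_mem h0).2 ⟨le_rfl, (WithTop.coe_le_coe.2 ?_).trans_lt h1⟩,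
      𝕌.shift_shift_mem.2 ?_⟩
    · linarith [ε.2]
    · rw [𝕌.point_x, neg_neg]
      exact ⟨WithTop.le_add_of_le hu le_rfl, h2⟩
  · obtain ⟨a, rfl⟩ := WithTop.ne_top_iff_exists.1 (hp.1.trans_lt (WithTop.coe_lt_top _)).ne
    obtain ⟨b, rfl⟩ := WithTop.ne_top_iff_exists.1 (hq.1.trans_lt (WithTop.coe_lt_top _)).ne
    have ha : a ≤ p.y := WithTop.coe_le_coe.1 hp.1
    have hb : b ≤ q.y := WithTop.coe_le_coe.1 hq.1
    have h1 : ((a + (ε + ε) : ℝ) : WithTop ℝ) < v :=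
      (WithTop.coe_le_coe.2 (by linarith)).trans_lt hp'.2
    have h2 := BlockCode.add_lt_of_key_le hkey h1
      ((WithTop.coe_le_coe.2 (by linarith)).trans_lt hq'.2)
    have h0 : 0 ≤ |a| + a := by linarith [neg_abs_le a]
    refine ⟨𝕌.point |a| a h0, (𝕌.point_mem h0).2 ⟨le_rfl, (WithTop.coe_le_coe.2 ?_).trans_lt h1⟩,
      𝕌.shift_shift_mem.2 ⟨WithTop.le_add_of_le hu le_rfl, h2⟩⟩
    linarith [ε.2]
  · exact ⟨p, hp, 𝕌.shift_shift_mem.2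
      ⟨WithTop.le_add_of_le hu hp.1, WithTop.le_add_of_le hv hp.2⟩⟩

end Key

end Persistence

/-! ### Linear algebra and partial matchings. -/

section Matching

open scoped Matrix

/-- Entries with a strictly larger row key are not controlled, and keys may coincide; block
triangularity with identity diagonal blocks still gives determinant `1`. An invertible matrix that
factors through `T` has rank at most the size of `T`. -/
theorem Matrix.card_le_card_of_mul_triangular {k α S T : Type*} [Field k] [LinearOrder α]
    [Fintype S] [DecidableEq S] [Fintype T] (key : S → α) (F : Matrix S T k) (G : Matrix T S k)
    (h : ∀ i l, key i ≤ key l → (F * G) i l = if i = l then 1 else 0) :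
    Fintype.card S ≤ Fintype.card T := by
  have htri : (F * G)ᵀ.BlockTriangular key := fun i j hij => by
    rw [Matrix.transpose_apply, h j i hij.le, if_neg]
    rintro rfl
    exact hij.false
  have hdet : (F * G).det = 1 := by
    rw [← Matrix.det_transpose, htri.det]
    refine Finset.prod_eq_one fun a _ => ?_
    have : (F * G)ᵀ.toSquareBlock key a = 1 := by
      ext i j
      rw [Matrix.toSquareBlock_def, Matrix.of_apply, Matrix.transpose_apply,
        h _ _ (j.2.trans i.2.symm).le, Matrix.one_apply]
      simp only [Subtype.ext_iff, eq_comm]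
    rw [this, Matrix.det_one]
  have hu : IsUnit (F * G) := (Matrix.isUnit_iff_isUnit_det _).2 (hdet ▸ isUnit_one)
  rw [← Matrix.rank_of_isUnit _ hu]
  exact (Matrix.rank_mul_le_left F G).trans (Matrix.rank_le_card_width F)

/-- Two injections that respect the relation `R` combine to a partial matching that covers both
domains. -/
theorem PEquiv.exists_of_injective {ι κ : Type*} {P : ι → Prop} {Q : κ → Prop}
    {R : ι → κ → Prop} {f : {i // P i} → κ} {g : {j // Q j} → ι} (hf : Function.Injective f)
    (hg : Function.Injective g) (hfR : ∀ i, R i.1 (f i)) (hgR : ∀ j, R (g j) j.1) :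
    ∃ σ : ι ≃. κ, (∀ i, σ i = none → ¬ P i) ∧ (∀ j, σ.symm j = none → ¬ Q j) ∧
      ∀ i j, σ i = some j → R i j := by
  classical
  -- Both sides get a supply of dummies. An index outside the domain goes to its own dummy at level
  -- `0`, and dummies move up one level to make room, so both maps become total injections. The
  -- relation `R'` lets an index meet a dummy only if it need not be matched.
  let f' : ι ⊕ (ι ⊕ κ) × ℕ → κ ⊕ (ι ⊕ κ) × ℕ := Sum.elim
    (fun i => if h : P i then Sum.inl (f ⟨i, h⟩) else Sum.inr (Sum.inl i, 0))
    (fun d => Sum.inr (d.1, d.2 + 1))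
  let g' : κ ⊕ (ι ⊕ κ) × ℕ → ι ⊕ (ι ⊕ κ) × ℕ := Sum.elim
    (fun j => if h : Q j then Sum.inl (g ⟨j, h⟩) else Sum.inr (Sum.inr j, 0))
    (fun d => Sum.inr (d.1, d.2 + 1))
  let R' : ι ⊕ (ι ⊕ κ) × ℕ → κ ⊕ (ι ⊕ κ) × ℕ → Prop := fun a b =>
    Sum.elim (fun i => Sum.elim (fun j => R i j) (fun _ => ¬ P i) b)
      (fun _ => Sum.elim (fun j => ¬ Q j) (fun _ => True) b) a
  have hf' : Function.Injective f' := by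
    rintro (i | ⟨s, n⟩) (i' | ⟨s', n'⟩) h <;> simp only [f', Sum.elim_inl, Sum.elim_inr] at h
    · split_ifs at h with h1 h2 h2
      · exact congrArg (fun x => Sum.inl x.1) (hf (Sum.inl.inj h))
      · simpa using h
    · split_ifs at h; simp at h
    · split_ifs at h; simp at h
    · simpa using h
  have hg' : Function.Injective g' := by
    rintro (i | ⟨s, n⟩) (i' | ⟨s', n'⟩) h <;> simp only [g', Sum.elim_inl, Sum.elim_inr] at h
    · split_ifs at h with h1 h2 h2
      · exact congrArg (fun x => Sum.inl x.1) (hg (Sum.inl.inj h))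
      · simpa using h
    · split_ifs at h; simp at h
    · split_ifs at h; simp at h
    · simpa using h
  obtain ⟨h, hbij, hR⟩ := Function.Embedding.schroeder_bernstein_of_rel hf' hg' R'
    (by
      rintro (i | d)
      · by_cases hi : P i
        · simpa [f', R', hi] using hfR ⟨i, hi⟩
        · simp [f', R', hi]
      · simp [f', R'])
    (by
      rintro (j | d)
      · by_cases hj : Q j
        · simpa [g', R', hj] using hgR ⟨j, hj⟩
        · simp [g', R', hj]
      · simp [g', R'])
  let e := Equiv.ofBijective h hbij
  have he : ∀ a, R' a (e a) := hR
  refine ⟨⟨fun i => (e (Sum.inl i)).getLeft?, fun j => (e.symm (Sum.inl j)).getLeft?, ?_⟩,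
    ?_, ?_, ?_⟩
  · intro i j
    rw [Sum.getLeft?_eq_some_iff, Sum.getLeft?_eq_some_iff, Equiv.symm_apply_eq]
    exact eq_comm
  · intro i hi
    obtain ⟨d, hd⟩ := Sum.isRight_iff.1 (Sum.getLeft?_eq_none_iff.1 hi)
    have := he (Sum.inl i)
    rw [hd] at this
    exact this
  · intro j hj
    obtain ⟨d, hd⟩ := Sum.isRight_iff.1 (Sum.getLeft?_eq_none_iff.1 hj)
    have := he (e.symm (Sum.inl j))
    rw [hd, ← hd, Equiv.apply_symm_apply, hd] at this
    exact this
  · intro i j hij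
    have := he (Sum.inl i)
    rw [Sum.getLeft?_eq_some_iff.1 hij] at this
    exact this

end Matching

/-! ### Hall's condition and the stability theorem. -/

namespace Persistence

/-- The end points of two blocks of the same kind differ by at most `ε`. -/
def BlockCode.Close (ε : ℝ) (c d : BlockCode) : Prop :=
  ShiftLE ε c d ∧ ShiftLE ε d c

/-- The block is not `2ε`-trivial. -/
def BlockCode.Persists (ε : ℝ≥0) (c : BlockCode) : Prop :=
  ∃ p ∈ c.toSet, 𝕌.shift ε (𝕌.shift ε p) ∈ c.toSet

open Classical in
/-- The matrices of an interleaving produce an injection from the nontrivial blocks of the one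
module to the blocks of the other module. -/
theorem exists_injective_close {k : Type u} [Field k] {ι : Type v} {κ : Type v'}
    {a : ι → BlockCode} {b : κ → BlockCode} {ε : ℝ≥0} {F : ι → κ → k} {G : κ → ι → k}
    (hF : ∀ i j, F i j ≠ 0 → HomRel ε (a i).toSet (b j).toSet)
    (hG : ∀ j i, G j i ≠ 0 → HomRel ε (b j).toSet (a i).toSet)
    (hfin : ∀ p, {j | p ∈ (b j).toSet}.Finite)
    (hFG : ∀ i l p (Z : Finset κ), (∀ j, j ∈ Z ↔ 𝕌.shift ε p ∈ (b j).toSet) →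
      p ∈ (a i).toSet → 𝕌.shift ε (𝕌.shift ε p) ∈ (a l).toSet →
      ∑ j ∈ Z, F i j * G j l = if i = l then 1 else 0) :
    ∃ m : {i // (a i).Persists ε} → κ, Function.Injective m ∧
      ∀ i, (a i.1).Close ε (b (m i)) := by
  have hclose : ∀ i : {i // (a i).Persists ε}, {j | (a i.1).Close ε (b j)}.Finite := by
    rintro ⟨i, p, hp, hp'⟩
    -- All blocks close to a persisting block contain one common point, the midpoint of its witness.
    exact (hfin (𝕌.shift ε p)).subset fun j hj => hj.1.shift_mem hj.2 hp hp'
  let t : {i // (a i).Persists ε} → Finset κ := fun i => (hclose i).toFinset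
  have ht : ∀ i j, j ∈ t i ↔ (a i.1).Close ε (b j) := fun i j => (hclose i).mem_toFinset
  suffices h : ∀ S : Finset {i // (a i).Persists ε}, S.card ≤ (S.biUnion t).card by
    obtain ⟨m, hm, hmt⟩ := (Finset.all_card_le_biUnion_card_iff_exists_injective t).1 h
    exact ⟨m, hm, fun i => (ht i _).1 (hmt i)⟩
  intro S
  have hterm : ∀ i j l, F i j * G j l ≠ 0 → (a i).key ≤ (a l).key →
      ShiftLE ε (a i) (b j) ∧ ShiftLE ε (b j) (a l) := by
    intro i j l hne hkey
    have h1 := (hF i j (left_ne_zero_of_mul hne)).rank_lt_or_shiftLE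
    have h2 := (hG j l (right_ne_zero_of_mul hne)).rank_lt_or_shiftLE
    have h3 := BlockCode.rank_le_of_key_le hkey
    rcases h1 with h1 | h1 <;> rcases h2 with h2 | h2
    · omega
    · rw [h2.kind] at h3; omega
    · rw [h1.kind] at h2; omega
    · exact ⟨h1, h2⟩
  have hsum : ∀ i ∈ S, ∀ l ∈ S, (a i.1).key ≤ (a l.1).key →
      ∑ j ∈ S.biUnion t, F i.1 j * G j l.1 = if i = l then 1 else 0 := by
    intro i hi l hl hkey
    -- If this holds, the `(i, l)` entry of the product is visible at some point; otherwise every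
    -- term of the sum vanishes.
    by_cases hil : ShiftLE (ε + ε) (a i.1) (a l.1)
    · obtain ⟨p, hp, hp'⟩ := hil.exists_mem hkey i.2 l.2
      have hZ : ∀ j, j ∈ (hfin (𝕌.shift ε p)).toFinset ↔ 𝕌.shift ε p ∈ (b j).toSet :=
        fun j => (hfin (𝕌.shift ε p)).mem_toFinset
      have h := hFG i.1 l.1 p _ hZ hp hp'
      simp only [Subtype.ext_iff]
      rw [← h]
      -- The sums over blocks alive at the midpoint and over neighbours of `S` agree: a nonzero term
      -- has `j` alive there by `shift_mem`, and close to `i` or `l` by `key_lt`.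
      refine Finset.sum_congr_of_eq_on_inter ?_ ?_ fun _ _ _ => rfl
      · intro j _ hj
        by_contra hne
        obtain ⟨h1, h2⟩ := hterm i.1 j l.1 hne hkey
        exact hj ((hZ j).2 (h1.shift_mem h2 hp hp'))
      · intro j _ hj
        by_contra hne
        obtain ⟨h1, h2⟩ := hterm i.1 j l.1 hne hkey
        refine (h1.key_lt h2 (fun h3 => hj ?_) (fun h3 => hj ?_)).not_ge hkey
        · exact Finset.mem_biUnion.2 ⟨i, hi, (ht i j).2 ⟨h1, h3⟩⟩
        · exact Finset.mem_biUnion.2 ⟨l, hl, (ht l j).2 ⟨h3, h2⟩⟩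
    · rw [if_neg, Finset.sum_eq_zero]
      · intro j _
        by_contra hne
        obtain ⟨h1, h2⟩ := hterm i.1 j l.1 hne hkey
        exact hil (h1.trans h2)
      · rintro rfl
        refine hil ⟨rfl, ?_, ?_⟩ <;>
        exact le_add_of_nonneg_right (WithTop.coe_nonneg.2 (by positivity))
  have hcard := Matrix.card_le_card_of_mul_triangular (S := S) (T := (S.biUnion t : Finset κ))
    (fun i => (a i.1.1).key) (Matrix.of fun i j => F i.1.1 j.1) (Matrix.of fun j i => G j.1 i.1.1)
    (by
      intro i l hkey
      rw [Matrix.mul_apply]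
      refine (Finset.sum_coe_sort (S.biUnion t) (fun j => F i.1.1 j * G j l.1.1)).trans ?_
      rw [hsum i.1 i.2 l.1 l.2 hkey]
      simp only [Subtype.ext_iff])
  rwa [Fintype.card_coe, Fintype.card_coe] at hcard

/-! ### Interleavings of close blocks. -/

section IntervalInterleaving

variable (k : Type u) [Field k]

theorem 𝕌.shift_two_mul (ε : ℝ≥0) (p : 𝕌) : 𝕌.shift (2 * ε) p = 𝕌.shift ε (𝕌.shift ε p) := by
  refine Subtype.ext (Prod.ext ?_ ?_)
  · change p.x - ((2 * ε : ℝ≥0) : ℝ) = p.x - ε - ε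
    push_cast; ring
  · change p.y + ((2 * ε : ℝ≥0) : ℝ) = p.y + ε + ε
    push_cast; ring

theorem isTrivial_intervalModule {I : PosetInterval 𝕌} {ε : ℝ≥0}
    (h : ¬ ∃ p ∈ I.carrier, 𝕌.shift ε (𝕌.shift ε p) ∈ I.carrier) :
    IsTrivial (2 * ε) (intervalModule k I) := by
  intro p
  apply ModuleCat.hom_ext
  apply LinearMap.ext
  intro (x : intervalSpace k I p)
  apply Subtype.ext
  change (intervalMap k I p (𝕌.shift (2 * ε) p) x : k) = 0
  by_cases hp : p ∈ I.carrier
  · exact intervalMap_coe_of_notMem k I (fun h' => h ⟨p, hp, 𝕌.shift_two_mul ε p ▸ h'⟩) x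
  · rw [show x = 0 from Subtype.ext (x.2 hp), map_zero, ZeroMemClass.coe_zero]

open Classical in
/-- The component at `p` of the canonical morphism between interval modules. -/
def intervalHomApp (ε : ℝ≥0) (I J : PosetInterval 𝕌) (p : 𝕌) :
    intervalSpace k I p →ₗ[k] intervalSpace k J (𝕌.shift ε p) where
  toFun x := ⟨if 𝕌.shift ε p ∈ J.carrier then (x : k) else 0, fun hq => if_neg hq⟩
  map_add' x y := by
    apply Subtype.ext
    by_cases h : 𝕌.shift ε p ∈ J.carrier <;> simp [h]
  map_smul' c x := by
    apply Subtype.ext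
    by_cases h : 𝕌.shift ε p ∈ J.carrier <;> simp [h]

variable {k} in
theorem intervalHomApp_coe_of_mem {ε : ℝ≥0} {I J : PosetInterval 𝕌} {p : 𝕌}
    (h : 𝕌.shift ε p ∈ J.carrier) (x : intervalSpace k I p) :
    (intervalHomApp k ε I J p x : k) = x :=
  if_pos h

/-- The canonical morphism between interval modules. -/
def intervalHom {ε : ℝ≥0} (I J : PosetInterval 𝕌)
    (h : ∀ p q, p ≤ q → p ∈ I.carrier → 𝕌.shift ε q ∈ J.carrier →
      𝕌.shift ε p ∈ J.carrier ∧ q ∈ I.carrier) :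
    intervalModule k I ⟶ shiftModule ε (intervalModule k J) where
  app p := ModuleCat.ofHom (intervalHomApp k ε I J p)
  naturality p q f := by
    apply ModuleCat.hom_ext
    apply LinearMap.ext
    intro (x : intervalSpace k I p)
    apply Subtype.ext
    change (intervalHomApp k ε I J q (intervalMap k I p q x) : k) =
      intervalMap k J (𝕌.shift ε p) (𝕌.shift ε q) (intervalHomApp k ε I J p x)
    by_cases hp : p ∈ I.carrier
    · by_cases hq : 𝕌.shift ε q ∈ J.carrier
      · obtain ⟨h1, h2⟩ := h p q (leOfHom f) hp hq
        rw [intervalHomApp_coe_of_mem hq, intervalMap_coe_of_mem k I h2,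
          intervalMap_coe_of_mem k J hq, intervalHomApp_coe_of_mem h1]
      · rw [intervalMap_coe_of_notMem k J hq]
        exact if_neg hq
    · have hx : x = 0 := Subtype.ext (x.2 hp)
      subst hx
      simp only [map_zero, ZeroMemClass.coe_zero]

theorem intervalHom_comp {ε : ℝ≥0} {I J : PosetInterval 𝕌} (h h')
    (hIJ : ∀ p ∈ I.carrier, 𝕌.shift ε (𝕌.shift ε p) ∈ I.carrier → 𝕌.shift ε p ∈ J.carrier)
    (p : 𝕌) : (intervalHom k I J h).app p ≫ (intervalHom k J I h').app (𝕌.shift ε p) =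
      (intervalModule k I).map
        (homOfLE ((𝕌.le_shift ε p).trans (𝕌.le_shift ε (𝕌.shift ε p)))) := by
  apply ModuleCat.hom_ext
  apply LinearMap.ext
  intro (x : intervalSpace k I p)
  apply Subtype.ext
  change (intervalHomApp k ε J I (𝕌.shift ε p) (intervalHomApp k ε I J p x) : k) =
    intervalMap k I p (𝕌.shift ε (𝕌.shift ε p)) x
  by_cases hp : p ∈ I.carrier
  · by_cases hq : 𝕌.shift ε (𝕌.shift ε p) ∈ I.carrier
    · rw [intervalHomApp_coe_of_mem hq, intervalHomApp_coe_of_mem (hIJ p hp hq),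
        intervalMap_coe_of_mem k I hq]
    · rw [intervalMap_coe_of_notMem k I hq]
      exact if_neg hq
  · have hx : x = 0 := Subtype.ext (x.2 hp)
    subst hx
    simp only [map_zero, ZeroMemClass.coe_zero]

theorem BlockCode.Close.interleaved {ε : ℝ≥0} {I J : PosetInterval 𝕌} {c d : BlockCode}
    (h : c.Close ε d) (hI : I.carrier = c.toSet) (hJ : J.carrier = d.toSet) :
    Interleaved ε (intervalModule k I) (intervalModule k J) := by
  refine ⟨intervalHom k I J fun p q hpq hp hq => ?_, intervalHom k J I fun p q hpq hp hq => ?_,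
    intervalHom_comp k _ _ fun p hp hp' => ?_, intervalHom_comp k _ _ fun p hp hp' => ?_⟩
  · rw [hI, hJ] at *
    exact h.1.mem_and_mem hpq hp hq
  · rw [hI, hJ] at *
    exact h.2.mem_and_mem hpq hp hq
  · rw [hI, hJ] at *
    exact h.1.shift_mem h.2 hp hp'
  · rw [hI, hJ] at *
    exact h.2.shift_mem h.1 hp hp'

end IntervalInterleaving

/-- The algebraic stability theorem for blocks. -/
theorem Interleaved.exists_isMatching {k : Type u} [Field k] {M N : 𝕌 ⥤ ModuleCat.{w} k}
    (hM : IsPFD M) (hN : IsPFD N) {ι : Type v} {κ : Type v'} {A : ι → PosetInterval 𝕌}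
    {B : κ → PosetInterval 𝕌} (hA : IsBarcode M A) (hB : IsBarcode N B)
    (hAblock : ∀ i, IsBlock (A i)) (hBblock : ∀ j, IsBlock (B j)) {ε : ℝ≥0}
    (h : Interleaved ε M N) : ∃ σ : ι ≃. κ, IsMatching k ε A B σ := by
  obtain ⟨b⟩ := hA.nonempty_basis
  obtain ⟨c⟩ := hB.nonempty_basis
  choose α hα using fun i => (hAblock i).exists_code
  choose β hβ using fun j => (hBblock j).exists_code
  obtain ⟨f, g, hfg, hgf⟩ := h
  obtain ⟨F, hF, hF'⟩ := b.exists_matrix c (fun j => hβ j ▸ (β j).joinClosed) f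
  obtain ⟨G, hG, hG'⟩ := c.exists_matrix b (fun i => hα i ▸ (α i).joinClosed) g
  have hFG := fun i l p => b.sum_mul_eq c f g hfg hF' hG' (i := i) (l := l) (p := p)
  have hGF := fun i l p => c.sum_mul_eq b g f hgf hG' hF' (i := i) (l := l) (p := p)
  have hb := b.finite_mem hM
  have hc := c.finite_mem hN
  simp only [hα, hβ] at hF hG hFG hGF hb hc
  obtain ⟨m, hm, hmclose⟩ := exists_injective_close hF hG hc hFG
  obtain ⟨n, hn, hnclose⟩ := exists_injective_close hG hF hb hGF
  obtain ⟨σ, h1, h2, h3⟩ := PEquiv.exists_of_injective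
    (R := fun i j => (α i).Close ε (β j)) hm hn hmclose (fun j => (hnclose j).symm)
  refine ⟨σ, fun i hi => isTrivial_intervalModule k ?_, fun j hj => isTrivial_intervalModule k ?_,
    fun i j hij => (h3 i j hij).interleaved k (hα i) (hβ j)⟩
  · rw [hα]
    exact h1 i hi
  · rw [hβ]
    exact h2 j hj

end Persistence

namespace Persistence

/-! ### From a matching to an interleaving. -/

section DirectSum

variable {k : Type u} [Field k] {ι : Type v} {κ : Type v'}

/-- The map between direct sums that is given by a partial bijection of the index sets and maps
between the summands. -/
def matchingMap [DecidableEq ι] [DecidableEq κ] {V : ι → Type*} {W : κ → Type*}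
    [∀ i, AddCommGroup (V i)]
    [∀ i, Module k (V i)] [∀ j, AddCommGroup (W j)] [∀ j, Module k (W j)] (σ : ι ≃. κ)
    (φ : ∀ i j, V i →ₗ[k] W j) : (⨁ i, V i) →ₗ[k] ⨁ j, W j :=
  DirectSum.toModule k ι _ fun i => (σ i).elim 0 fun j => DirectSum.lof k κ W j ∘ₗ φ i j

section

variable [DecidableEq ι] [DecidableEq κ] {V V' : ι → Type*} {W W' : κ → Type*}
  [∀ i, AddCommGroup (V i)] [∀ i, Module k (V i)]
  [∀ i, AddCommGroup (V' i)] [∀ i, Module k (V' i)]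
  [∀ j, AddCommGroup (W j)] [∀ j, Module k (W j)]
  [∀ j, AddCommGroup (W' j)] [∀ j, Module k (W' j)] (σ : ι ≃. κ)

theorem matchingMap_lof_none (φ : ∀ i j, V i →ₗ[k] W j) {i : ι} (h : σ i = none) (x : V i) :
    matchingMap σ φ (DirectSum.lof k ι V i x) = 0 := by
  rw [matchingMap, DirectSum.toModule_lof, h]
  rfl

theorem matchingMap_lof_some (φ : ∀ i j, V i →ₗ[k] W j) {i : ι} {j : κ} (h : σ i = some j)
    (x : V i) :
    matchingMap σ φ (DirectSum.lof k ι V i x) = DirectSum.lof k κ W j (φ i j x) := by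
  rw [matchingMap, DirectSum.toModule_lof, h]
  rfl

theorem matchingMap_lmap (φ : ∀ i j, V i →ₗ[k] W j) (φ' : ∀ i j, V' i →ₗ[k] W' j)
    (α : ∀ i, V i →ₗ[k] V' i) (β : ∀ j, W j →ₗ[k] W' j)
    (h : ∀ i j x, φ' i j (α i x) = β j (φ i j x)) (x : ⨁ i, V i) :
    matchingMap σ φ' (DirectSum.lmap α x) = DirectSum.lmap β (matchingMap σ φ x) := by
  refine LinearMap.congr_fun (f := matchingMap σ φ' ∘ₗ DirectSum.lmap α)
    (g := DirectSum.lmap β ∘ₗ matchingMap σ φ) (DirectSum.linearMap_ext k fun i => ?_) x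
  ext1 x
  simp only [LinearMap.comp_apply, DirectSum.lmap_lof]
  cases hi : σ i with
  | none => rw [matchingMap_lof_none σ _ hi, matchingMap_lof_none σ _ hi, map_zero]
  | some j => rw [matchingMap_lof_some σ _ hi, matchingMap_lof_some σ _ hi, DirectSum.lmap_lof, h]

theorem matchingMap_comp (φ : ∀ i j, V i →ₗ[k] W j) (ψ : ∀ j i, W j →ₗ[k] V' i)
    (α : ∀ i, V i →ₗ[k] V' i) (hnone : ∀ i, σ i = none → α i = 0)
    (hsome : ∀ i j, σ i = some j → ∀ x, ψ j i (φ i j x) = α i x) (x : ⨁ i, V i) :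
    matchingMap σ.symm ψ (matchingMap σ φ x) = DirectSum.lmap α x := by
  refine LinearMap.congr_fun (f := matchingMap σ.symm ψ ∘ₗ matchingMap σ φ)
    (g := DirectSum.lmap α) (DirectSum.linearMap_ext k fun i => ?_) x
  ext1 x
  simp only [LinearMap.comp_apply, DirectSum.lmap_lof]
  cases hi : σ i with
  | none => rw [matchingMap_lof_none σ _ hi, map_zero, hnone i hi, LinearMap.zero_apply, map_zero]
  | some j =>
    rw [matchingMap_lof_some σ _ hi,
      matchingMap_lof_some σ.symm _ ((PEquiv.eq_some_iff σ).2 hi), hsome i j hi]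

end

theorem IsTrivial.map_shift_shift {ε : ℝ≥0} {M : 𝕌 ⥤ ModuleCat.{w} k} (h : IsTrivial (2 * ε) M)
    (p : 𝕌) :
    M.map (homOfLE ((𝕌.le_shift ε p).trans (𝕌.le_shift ε (𝕌.shift ε p)))) = 0 := by
  -- The shift by `2 * ε` and the double shift are equal points, but not by definition, so the end
  -- point is generalised first.
  have : ∀ q (hpq : p ≤ q), q = 𝕌.shift (2 * ε) p → M.map (homOfLE hpq) = 0 := by
    rintro _ _ rfl
    exact h p
  exact this _ _ (𝕌.shift_two_mul ε p).symm

open Classical in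
/-- The morphism between modules with barcodes that is assembled from morphisms between matched
interval modules. -/
def matchingHom {M N : 𝕌 ⥤ ModuleCat.{w} k} {A : ι → PosetInterval 𝕌} {B : κ → PosetInterval 𝕌}
    (d : ∀ p, M.obj p ≃ₗ[k] (⨁ i, (intervalModule k (A i)).obj p))
    (e : ∀ p, N.obj p ≃ₗ[k] (⨁ j, (intervalModule k (B j)).obj p))
    (hd : ∀ ⦃p q : 𝕌⦄ (h : p ⟶ q) (m : M.obj p), d q ((M.map h).hom m) =
      DirectSum.lmap (fun i => ((intervalModule k (A i)).map h).hom) (d p m))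
    (he : ∀ ⦃p q : 𝕌⦄ (h : p ⟶ q) (m : N.obj p), e q ((N.map h).hom m) =
      DirectSum.lmap (fun i => ((intervalModule k (B i)).map h).hom) (e p m))
    (ε : ℝ≥0) (σ : ι ≃. κ)
    (f : ∀ i j, intervalModule k (A i) ⟶ shiftModule ε (intervalModule k (B j))) :
    M ⟶ shiftModule ε N where
  app p := ModuleCat.ofHom ((e (𝕌.shift ε p)).symm.toLinearMap ∘ₗ
    matchingMap (W := fun j => (intervalModule k (B j)).obj (𝕌.shift ε p)) σ
      (fun i j => ((f i j).app p).hom) ∘ₗ (d p).toLinearMap)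
  naturality p q h := by
    apply ModuleCat.hom_ext
    apply LinearMap.ext
    intro m
    apply (e (𝕌.shift ε q)).injective
    change e (𝕌.shift ε q) ((e (𝕌.shift ε q)).symm (matchingMap
      (W := fun j => (intervalModule k (B j)).obj (𝕌.shift ε q)) σ
      (fun i j => ((f i j).app q).hom) (d q ((M.map h).hom m)))) =
      e (𝕌.shift ε q) ((N.map (homOfLE (𝕌.shift_mono ε (leOfHom h)))).hom
        ((e (𝕌.shift ε p)).symm (matchingMap
          (W := fun j => (intervalModule k (B j)).obj (𝕌.shift ε p)) σ
          (fun i j => ((f i j).app p).hom) (d p m))))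
    rw [he, LinearEquiv.apply_symm_apply, LinearEquiv.apply_symm_apply, hd]
    refine matchingMap_lmap σ _ _ _ _ (fun i j x => ?_) _
    exact congrArg (fun g => g.hom x) ((f i j).naturality h)

theorem matchingHom_comp {M N : 𝕌 ⥤ ModuleCat.{w} k} {A : ι → PosetInterval 𝕌}
    {B : κ → PosetInterval 𝕌}
    (d : ∀ p, M.obj p ≃ₗ[k] (⨁ i, (intervalModule k (A i)).obj p))
    (e : ∀ p, N.obj p ≃ₗ[k] (⨁ j, (intervalModule k (B j)).obj p)) (hd he)
    {ε : ℝ≥0} {σ : ι ≃. κ}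
    {f : ∀ i j, intervalModule k (A i) ⟶ shiftModule ε (intervalModule k (B j))}
    {g : ∀ j i, intervalModule k (B j) ⟶ shiftModule ε (intervalModule k (A i))}
    (hnone : ∀ i, σ i = none → IsTrivial (2 * ε) (intervalModule k (A i)))
    (hsome : ∀ i j, σ i = some j → ∀ p, (f i j).app p ≫ (g j i).app (𝕌.shift ε p) =
      (intervalModule k (A i)).map
        (homOfLE ((𝕌.le_shift ε p).trans (𝕌.le_shift ε (𝕌.shift ε p))))) (p : 𝕌) :
    (matchingHom d e hd he ε σ f).app p ≫
      (matchingHom e d he hd ε σ.symm g).app (𝕌.shift ε p) =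
      M.map (homOfLE ((𝕌.le_shift ε p).trans (𝕌.le_shift ε (𝕌.shift ε p)))) := by
  classical
  apply ModuleCat.hom_ext
  apply LinearMap.ext
  intro m
  apply (d (𝕌.shift ε (𝕌.shift ε p))).injective
  refine Eq.trans ?_ (hd _ m).symm
  change d (𝕌.shift ε (𝕌.shift ε p)) ((d (𝕌.shift ε (𝕌.shift ε p))).symm (matchingMap
      (W := fun i => (intervalModule k (A i)).obj (𝕌.shift ε (𝕌.shift ε p))) σ.symm
      (fun j i => ((g j i).app (𝕌.shift ε p)).hom) (e (𝕌.shift ε p) ((e (𝕌.shift ε p)).symm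
        (matchingMap (W := fun j => (intervalModule k (B j)).obj (𝕌.shift ε p)) σ
          (fun i j => ((f i j).app p).hom) (d p m)))))) = _
  rw [LinearEquiv.apply_symm_apply, LinearEquiv.apply_symm_apply]
  refine matchingMap_comp σ _ _ _ (fun i hi => ?_) (fun i j hij x => ?_) _
  · rw [(hnone i hi).map_shift_shift p]
    rfl
  · exact congrArg (fun g => g.hom x) (hsome i j hij p)

/-- Modules with `ε`-matched barcodes are `ε`-interleaved. -/
theorem IsMatching.interleaved {M N : 𝕌 ⥤ ModuleCat.{w} k} {A : ι → PosetInterval 𝕌}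
    {B : κ → PosetInterval 𝕌} (hA : IsBarcode M A) (hB : IsBarcode N B) {ε : ℝ≥0} {σ : ι ≃. κ}
    (h : IsMatching k ε A B σ) : Interleaved ε M N := by
  obtain ⟨d, hd⟩ := hA
  obtain ⟨e, he⟩ := hB
  have key : ∀ i j, ∃ (f : intervalModule k (A i) ⟶ shiftModule ε (intervalModule k (B j)))
      (g : intervalModule k (B j) ⟶ shiftModule ε (intervalModule k (A i))), σ i = some j →
      (∀ p, f.app p ≫ g.app (𝕌.shift ε p) = (intervalModule k (A i)).map
        (homOfLE ((𝕌.le_shift ε p).trans (𝕌.le_shift ε (𝕌.shift ε p))))) ∧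
      (∀ p, g.app p ≫ f.app (𝕌.shift ε p) = (intervalModule k (B j)).map
        (homOfLE ((𝕌.le_shift ε p).trans (𝕌.le_shift ε (𝕌.shift ε p))))) := by
    intro i j
    by_cases hij : σ i = some j
    · obtain ⟨f, g, hfg⟩ := h.matched i j hij
      exact ⟨f, g, fun _ => hfg⟩
    · exact ⟨0, 0, fun h => absurd h hij⟩
  choose f g hfg using key
  refine ⟨matchingHom d e hd he ε σ f, matchingHom e d he hd ε σ.symm fun j i => g i j, ?_, ?_⟩
  · exact matchingHom_comp d e hd he h.left fun i j hij => (hfg i j hij).1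
  · exact matchingHom_comp e d he hd (σ := σ.symm) (g := f) h.right fun j i hij =>
      (hfg i j ((PEquiv.eq_some_iff σ).1 hij)).2

end DirectSum

end Persistence

end

theorem theorem3p17 {k : Type u} [Field k]
    (M N : Persistence.𝕌 ⥤ ModuleCat.{w} k)
    (hM : Persistence.IsPFD M) (hN : Persistence.IsPFD N)
    {ι : Type v} {κ : Type v'}
    (A : ι → Persistence.PosetInterval Persistence.𝕌) (B : κ → Persistence.PosetInterval Persistence.𝕌)
    (hA : Persistence.IsBarcode M A) (hB : Persistence.IsBarcode N B)
    (hAblock : ∀ i, Persistence.IsBlock (A i)) (hBblock : ∀ j, Persistence.IsBlock (B j))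
    (ε : ℝ≥0) :
    (∃ σ : ι ≃. κ, Persistence.IsMatching k ε A B σ) ↔ Persistence.Interleaved ε M N :=
  ⟨fun ⟨_, hσ⟩ => hσ.interleaved hA hB,
    fun h => h.exists_isMatching hM hN hA hB hAblock hBblock⟩
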